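/- Let $0<\alpha<1$, $p\in\mathbb{R}$, $b<X$, and let $y$ be a real-valued function on $[b,X]$, extended by $y(t)=0$ for $t<b$ (this extension is used only when $p<0$). For $h>0$ and $b\le x\le X$ let $$\Delta^{\alpha}_{h,p}y(x)=\sum_{n=0}^{N_{x,h}}(-1)^n\binom{\alpha}{n}\,y\bigl(x-(n-p)h\bigr),\qquad N_{x,h}=\Bigl\lfloor\frac{x-b}{h}\Bigr\rfloor,\qquad \binom{\alpha}{n}=\frac{\alpha(\alpha-1)\cdots(\alpha-n+1)}{n!},$$ be the shifted Grünwald difference operator, let $$y^{(\alpha)}(x)=\frac{1}{\Gamma(1-\alpha)}\int_b^x\frac{y'(\xi)}{(x-\xi)^{\alpha}}\,d\xi$$ be the Caputo derivative with lower limit $b$, and let $y^{(2+\alpha)}=\frac{d^2}{dx^2}y^{(\alpha)}$ on $[b,X]$ (derivatives at end points are one-sided). Call $(x,h)$ admissible if $h>0$, $b\le x\le X$, $x+ph\le X$ and $x+(p-\alpha/2)h\ge b$. (i) If $y\in C^4[b,X]$ and $y(b)=y'(b)=y''(b)=0$, then $$h^{-\alpha}\Delta^\alpha_{h,p}y(x)=y^{(\alpha)}\Bigl(x+\bigl(p-\tfrac{\alpha}{2}\bigr)h\Bigr)+O(h^2).$$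 (ii) If $y\in C^5[b,X]$ and $y(b)=y'(b)=y''(b)=y'''(b)=0$, then $y^{(\alpha)}$ is twice continuously differentiable on $[b,X]$ and $$h^{-\alpha}\Delta^\alpha_{h,p}y(x)=y^{(\alpha)}\Bigl(x+\bigl(p-\tfrac{\alpha}{2}\bigr)h\Bigr)+\frac{\alpha}{24}h^2\,y^{(2+\alpha)}(x)+O(h^3).$$ Here $O(h^k)$ denotes a quantity of absolute value at most $Ch^k$ for all admissible $(x,h)$, with a constant $C$ depending on $\alpha,p,b,X,y$ but not on $x$ or $h$. -/

import Mathlib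

/-- The Grünwald weights `w_n = (-1)^n * binom(α, n)`, where
`binom(α, n) = α (α - 1) ⋯ (α - n + 1) / n!` is the generalized binomial coefficient. -/
noncomputable def grunwaldWeight (α : ℝ) (n : ℕ) : ℝ :=
  (-1) ^ n * Ring.choose α n

/-- The shifted Grünwald difference operator with lower limit `b`, step `h` and shift `p`,
`Δ y (x) = ∑_{n=0}^{N} w_n y(x - (n - p) h)`, where `N = [(x - b) / h]`. -/
noncomputable def shiftedGrunwald (α p b h : ℝ) (y : ℝ → ℝ) (x : ℝ) : ℝ :=
  ∑ n ∈ Finset.range (⌊(x - b) / h⌋₊ + 1), grunwaldWeight α n * y (x - ((n : ℝ) - p) * h)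

/-- The Caputo derivative of order `α`, `0 < α < 1`, with lower limit `b`, at a point `x ≥ b`:
`y^(α)(x) = 1 / Γ(1 - α) * ∫_b^x y'(ξ) / (x - ξ)^α dξ`.
Only the values of `y'` in the open interval `(b, x)` matter. -/
noncomputable def caputoDeriv (α b : ℝ) (y : ℝ → ℝ) (x : ℝ) : ℝ :=
  1 / Real.Gamma (1 - α) * ∫ ξ in b..x, deriv y ξ / (x - ξ) ^ α

/-- The Miller-Ross sequential derivative `y^(2+α) = d²/dx² y^(α)` of order `2 + α`, where `y^(α)`
is the Caputo derivative with lower limit `b`, taken on the interval `[b, X]`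
(so one-sided at the two end points). -/
noncomputable def millerRossDerivTwo (α b X : ℝ) (y : ℝ → ℝ) (x : ℝ) : ℝ :=
  iteratedDerivWithin 2 (caputoDeriv α b y) (Set.Icc b X) x

open Filter Topology Set MeasureTheory

/-! Write T_γ(t) = t₊^γ / Γ(γ + 1). If y vanishes at b to order m (m = 2 or 3) and μ = m + 1,
Taylor's formula with integral remainder gives y(z) = c T_μ(z - b) + ∫ T_μ(z - s) f(s) ds with c =
y^(m+1)(b), f = y^(m+2), and the Caputo derivative is the same superposition of T_{μ-α}
(`exists_eq_truncPotential`). All terms are linear in the kernel and T_γ is homogeneous, so scaling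
reduces the theorem to step one: ∑ w_n T_μ(v - n) equals T_{μ-α}(v - α/2), plus (α/24) T_{2-α}(v -
α/2) when μ = 4, up to O((1 + v₊)^(1-α)).

For integer μ this sum is explicit: with v = N + θ, it is the partial sum g_N = Γ(N + 1 - α) / (Γ(1
- α) N!) of the weights times a polynomial in N and θ. In the centred variable w = N + (1 - α)/2 one
has Γ(1 - α) g_N w^α = 1 + k/w² + O(w⁻³) (`exists_abs_gammaRatio_sub_one_le`), and v - α/2 = w + τ
with τ = θ - 1/2, so both sides can be compared in powers of 1/w.

Two corrections remain. For p > 0 the difference may stop before the support is exhausted, but the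
missing terms sit within ph of b and are O(h^μ). In (ii) the second-order term appears at the
shifted point and is moved to x by a Lipschitz bound. -/

/-! ### Grünwald weights and their partial sums -/

theorem grunwaldWeight_zero (α : ℝ) : grunwaldWeight α 0 = 1 := by
  simp [grunwaldWeight]

theorem grunwaldWeight_succ (α : ℝ) (n : ℕ) :
    ((n : ℝ) + 1) * grunwaldWeight α (n + 1) = (n - α) * grunwaldWeight α n := by
  have h1 := Ring.descPochhammer_eq_factorial_smul_choose α n
  have h2 := Ring.descPochhammer_eq_factorial_smul_choose α (n + 1)
  rw [descPochhammer_succ_right, Polynomial.smeval_mul, h1] at h2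
  simp only [nsmul_eq_mul, Nat.factorial_succ, Nat.cast_mul, Polynomial.smeval_sub,
    Polynomial.smeval_X, Polynomial.smeval_natCast, pow_one, pow_zero, mul_one] at h2
  have hn : (n.factorial : ℝ) ≠ 0 := by positivity
  have h3 : (α - n) * Ring.choose α n = ((n : ℝ) + 1) * Ring.choose α (n + 1) := by
    apply mul_left_cancel₀ hn
    push_cast at h2
    linear_combination h2
  unfold grunwaldWeight
  rw [pow_succ]
  linear_combination (-(-1 : ℝ) ^ n) * (-h3)

theorem abs_grunwaldWeight_le_one {α : ℝ} (h0 : 0 < α) (h1 : α < 1) (n : ℕ) :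
    |grunwaldWeight α n| ≤ 1 := by
  induction n with
  | zero => simp [grunwaldWeight_zero]
  | succ n ih =>
    have h := congrArg abs (grunwaldWeight_succ α n)
    rw [abs_mul, abs_mul, abs_of_pos (by positivity : (0 : ℝ) < n + 1)] at h
    have h2 : |(n : ℝ) - α| ≤ n + 1 := by
      have : (0 : ℝ) ≤ n := n.cast_nonneg
      rw [abs_le]; constructor <;> linarith
    have h3 : |(n : ℝ) - α| * |grunwaldWeight α n| ≤ (n + 1) * 1 :=
      mul_le_mul h2 ih (abs_nonneg _) (by positivity)
    rw [← h] at h3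
    exact le_of_mul_le_mul_left h3 (by positivity)

/-- The partial sums of the Grünwald weights. -/
noncomputable def grunwaldSum (α : ℝ) (N : ℕ) : ℝ :=
  ∑ n ∈ Finset.range (N + 1), grunwaldWeight α n

theorem grunwaldSum_zero (α : ℝ) : grunwaldSum α 0 = 1 := by
  simp [grunwaldSum, grunwaldWeight_zero]

theorem grunwaldWeight_succ_eq_sum (α : ℝ) (n : ℕ) :
    ((n : ℝ) + 1) * grunwaldWeight α (n + 1) = -α * grunwaldSum α n := by
  induction n with
  | zero => simpa [grunwaldSum_zero, grunwaldWeight_zero] using grunwaldWeight_succ α 0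
  | succ n ih =>
    have h := grunwaldWeight_succ α (n + 1)
    rw [h, grunwaldSum, Finset.sum_range_succ, ← grunwaldSum]
    push_cast
    linear_combination ih

theorem grunwaldSum_succ (α : ℝ) (n : ℕ) :
    ((n : ℝ) + 1) * grunwaldSum α (n + 1) = (n + 1 - α) * grunwaldSum α n := by
  have h := grunwaldWeight_succ_eq_sum α n
  rw [grunwaldSum, Finset.sum_range_succ, ← grunwaldSum]
  linear_combination h

theorem grunwaldSum_pos {α : ℝ} (h1 : α < 1) (n : ℕ) : 0 < grunwaldSum α n := by
  induction n with
  | zero => simp [grunwaldSum_zero]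
  | succ n ih =>
    have h := grunwaldSum_succ α n
    have h2 : 0 < (n + 1 - α) * grunwaldSum α n := by
      have : (0 : ℝ) ≤ n := n.cast_nonneg
      exact mul_pos (by linarith) ih
    rw [← h] at h2
    exact (pos_iff_pos_of_mul_pos h2).1 (by positivity)

/-! ### Closed forms for convolutions of the weights with powers -/

/-- If polynomials `P` satisfy the recursion of the convolution `∑ w_n g(N - n + θ)` then they
compute it. -/
theorem sum_grunwaldWeight_mul_eq {α D : ℝ} {g : ℝ → ℝ} {P : ℝ → ℝ → ℝ}
    (h0 : ∀ θ, D * g θ = P 0 θ)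
    (hs : ∀ N θ, (N + 1) * P N (θ + 1) - α * (D * g θ) = (N + 1 - α) * P (N + 1) θ)
    (N : ℕ) (θ : ℝ) :
    D * ∑ n ∈ Finset.range (N + 1), grunwaldWeight α n * g (N - n + θ) =
      grunwaldSum α N * P N θ := by
  -- Passing from N to N + 1 shifts θ by one and appends the term w_{N+1} g(θ), so the induction
  -- hypothesis is needed at θ + 1.
  induction N generalizing θ with
  | zero => simp [grunwaldSum_zero, grunwaldWeight_zero, h0]
  | succ N ih =>
    have hN : ((N : ℝ) + 1) ≠ 0 := by positivity
    rw [Finset.sum_range_succ]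
    have e : ∀ n : ℕ, ((N + 1 : ℕ) : ℝ) - n + θ = N - n + (θ + 1) := fun n => by push_cast; ring
    simp only [e]
    rw [mul_add, ih]
    have e2 : (N : ℝ) - ((N + 1 : ℕ) : ℝ) + (θ + 1) = θ := by push_cast; ring
    rw [e2]
    apply mul_left_cancel₀ hN
    have a1 := grunwaldSum_succ α N
    have a2 := grunwaldWeight_succ_eq_sum α N
    push_cast
    linear_combination D * g θ * a2 - P (N + 1) θ * a1 + grunwaldSum α N * hs N θ

/-- The polynomial `(1 - α)(2 - α)(3 - α) ∑ w_n (N - n + θ)³` divided by `∑ w_n`. -/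
noncomputable def cubicGrunwaldPoly (α N θ : ℝ) : ℝ :=
  6 * ((N + 1 - α) * (N + 2 - α) * (N + 3 - α))
    + (-12 + 6 * θ) * (3 - α) * ((N + 1 - α) * (N + 2 - α))
    + (7 - 9 * θ + 3 * θ ^ 2) * ((3 - α) * (2 - α)) * (N + 1 - α)
    + (-1 + 3 * θ - 3 * θ ^ 2 + θ ^ 3) * ((3 - α) * (2 - α) * (1 - α))

/-- The polynomial `(1 - α)(2 - α)(3 - α)(4 - α) ∑ w_n (N - n + θ)⁴` divided by `∑ w_n`. -/
noncomputable def quarticGrunwaldPoly (α N θ : ℝ) : ℝ :=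
  24 * ((N + 1 - α) * (N + 2 - α) * (N + 3 - α) * (N + 4 - α))
    + (-60 + 24 * θ) * (4 - α) * ((N + 1 - α) * (N + 2 - α) * (N + 3 - α))
    + (50 - 48 * θ + 12 * θ ^ 2) * ((4 - α) * (3 - α)) * ((N + 1 - α) * (N + 2 - α))
    + (-15 + 28 * θ - 18 * θ ^ 2 + 4 * θ ^ 3) * ((4 - α) * (3 - α) * (2 - α)) * (N + 1 - α)
    + (1 - 4 * θ + 6 * θ ^ 2 - 4 * θ ^ 3 + θ ^ 4) * ((4 - α) * (3 - α) * (2 - α) * (1 - α))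

/-- The polynomial comes from expanding (t + θ)³ in the binomials C(t + j, j): the generating
function (1 - x)^α (1 - x)^(-1-j) shows that convolving these with the weights multiplies g_N by (N
+ 1 - α)⋯(N + j - α) / ((1 - α)⋯(j - α)). Once it is known, checking the recursion suffices. -/
theorem sum_grunwaldWeight_mul_cube (α : ℝ) (N : ℕ) (θ : ℝ) :
    (1 - α) * (2 - α) * (3 - α) *
        ∑ n ∈ Finset.range (N + 1), grunwaldWeight α n * (N - n + θ) ^ 3 =
      grunwaldSum α N * cubicGrunwaldPoly α N θ :=
  sum_grunwaldWeight_mul_eq (g := fun t => t ^ 3) (P := cubicGrunwaldPoly α)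
    (fun θ => by simp only [cubicGrunwaldPoly]; ring)
    (fun N θ => by simp only [cubicGrunwaldPoly]; ring) N θ

theorem sum_grunwaldWeight_mul_fourth (α : ℝ) (N : ℕ) (θ : ℝ) :
    (1 - α) * (2 - α) * (3 - α) * (4 - α) *
        ∑ n ∈ Finset.range (N + 1), grunwaldWeight α n * (N - n + θ) ^ 4 =
      grunwaldSum α N * quarticGrunwaldPoly α N θ :=
  sum_grunwaldWeight_mul_eq (g := fun t => t ^ 4) (P := quarticGrunwaldPoly α)
    (fun θ => by simp only [quarticGrunwaldPoly]; ring)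
    (fun N θ => by simp only [quarticGrunwaldPoly]; ring) N θ

/-! ### Asymptotics of the partial sums -/

theorem exists_abs_one_add_rpow_sub_sum_le (γ : ℝ) (n : ℕ) :
    ∃ C > 0, ∀ x : ℝ, |x| ≤ 1 / 2 →
      |(1 + x) ^ γ - ∑ k ∈ Finset.range n, Ring.choose γ k * x ^ k| ≤ C * |x| ^ n := by
  -- The radius 3/4 lies strictly between the range 1/2 of x and the radius of convergence 1.
  obtain ⟨a, ha, C, hC, h⟩ := (Real.one_add_rpow_hasFPowerSeriesOnBall_zero
    (a := γ)).uniform_geometric_approx' (r' := 3 / 4) (by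
      have : ((3 / 4 : NNReal) : ENNReal) < ((1 : NNReal) : ENNReal) := by
        rw [ENNReal.coe_lt_coe, ← NNReal.coe_lt_coe]; norm_num
      simpa using this)
  have ha0 : 0 < a := ha.1
  refine ⟨C * (a / (3 / 4)) ^ n, by positivity, fun x hx => ?_⟩
  have h1 := h x (by
    rw [Metric.mem_ball, dist_zero_right, Real.norm_eq_abs]
    have : ((3 / 4 : NNReal) : ℝ) = 3 / 4 := by norm_num
    rw [this]; linarith) n
  have e : (binomialSeries ℝ γ).partialSum n x =
      ∑ k ∈ Finset.range n, Ring.choose γ k * x ^ k := by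
    simp [FormalMultilinearSeries.partialSum, binomialSeries,
      FormalMultilinearSeries.coeff_ofScalars, mul_comm]
  rw [e, zero_add, Real.norm_eq_abs, Real.norm_eq_abs] at h1
  refine h1.trans (le_of_eq ?_)
  have : ((3 / 4 : NNReal) : ℝ) = 3 / 4 := by norm_num
  rw [this]
  ring

theorem ringChoose_two (γ : ℝ) : Ring.choose γ 2 = γ * (γ - 1) / 2 := by
  have h := grunwaldWeight_succ γ 0
  have h2 := grunwaldWeight_succ γ 1
  simp [grunwaldWeight] at h h2
  linarith

theorem ringChoose_three (γ : ℝ) : Ring.choose γ 3 = γ * (γ - 1) * (γ - 2) / 6 := by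
  have h := grunwaldWeight_succ γ 2
  norm_num [grunwaldWeight, ringChoose_two] at h
  linarith

/-- A sequence with limit `1` whose increments are `O(w⁻⁴)` is `1 + O(w⁻³)`. -/
theorem abs_sub_one_le_of_abs_sub_le {ρ : ℕ → ℝ} {w₀ C : ℝ} (hw : 2 ≤ w₀)
    (hC : 0 ≤ C) (hlim : Tendsto ρ atTop (𝓝 1))
    (hρ : ∀ n : ℕ, |ρ (n + 1) - ρ n| ≤ C / (w₀ + n) ^ 4) (n : ℕ) :
    |ρ n - 1| ≤ C / (w₀ + n) ^ 3 := by
  -- Telescoping majorant: it makes ρ + C/w³ decreasing and ρ - C/w³ increasing, both with limit 1.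
  have key : ∀ n : ℕ, C / (w₀ + n) ^ 4 ≤ C / (w₀ + n) ^ 3 - C / (w₀ + (n + 1 : ℕ)) ^ 3 := by
    intro n
    have hn : (0 : ℝ) ≤ n := n.cast_nonneg
    push_cast
    rw [← add_assoc]
    generalize hz : w₀ + n = z
    have hz2 : 2 ≤ z := by linarith
    have : 1 / z ^ 4 ≤ 1 / z ^ 3 - 1 / (z + 1) ^ 3 := by
      rw [div_sub_div _ _ (by positivity) (by positivity), div_le_div_iff₀ (by positivity)
        (by positivity)]
      have h5 : 0 ≤ z ^ 3 * (2 * z ^ 3 - 2 * z - 1) := by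
        have : 0 ≤ 2 * z ^ 3 - 2 * z - 1 := by
          nlinarith [mul_nonneg (by linarith : 0 ≤ z - 2) (by positivity : 0 ≤ z ^ 2)]
        positivity
      nlinarith
    calc C / z ^ 4 = C * (1 / z ^ 4) := by ring
      _ ≤ C * (1 / z ^ 3 - 1 / (z + 1) ^ 3) := by gcongr
      _ = _ := by ring
  have hlim0 : Tendsto (fun n : ℕ => C / (w₀ + n) ^ 3) atTop (𝓝 0) := by
    apply Tendsto.const_div_atTop
    apply (tendsto_pow_atTop (by norm_num)).comp
    exact tendsto_atTop_add_const_left _ _ tendsto_natCast_atTop_atTop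
  have hanti : Antitone (fun n : ℕ => ρ n + C / (w₀ + n) ^ 3) := by
    apply antitone_nat_of_succ_le
    intro n
    have := (abs_le.1 (hρ n)).2
    linarith [key n]
  have hmono : Monotone (fun n : ℕ => ρ n - C / (w₀ + n) ^ 3) := by
    apply monotone_nat_of_le_succ
    intro n
    have := (abs_le.1 (hρ n)).1
    linarith [key n]
  have h1 := hanti.le_of_tendsto (by simpa using hlim.add hlim0) n
  have h2 := hmono.ge_of_tendsto (by simpa using hlim.sub hlim0) n
  rw [abs_le]
  constructor <;> linarith

/-- The second-order coefficient in the expansion of `Γ(N + 1 - α) / N!`. -/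
noncomputable def gammaRatioCoeff (α : ℝ) : ℝ := α * (α ^ 2 - 1) / 24

theorem gammaRatioCoeff_nonpos {α : ℝ} (h0 : 0 < α) (h1 : α < 1) : gammaRatioCoeff α ≤ 0 := by
  unfold gammaRatioCoeff
  nlinarith [mul_pos h0 (sub_pos.2 h1)]

theorem neg_le_gammaRatioCoeff {α : ℝ} (h0 : 0 < α) (h1 : α < 1) :
    -(1 / 2) ≤ gammaRatioCoeff α := by
  unfold gammaRatioCoeff
  nlinarith [mul_pos h0 (sub_pos.2 h1)]

/-- With x = 1/w, this is numerator minus denominator of the ratio of consecutive values of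
`grunwaldSumQuotient`. The centring of w cancels the order x², and `gammaRatioCoeff` is the value
that cancels x³. -/
theorem exists_abs_poly_mul_rpow_sub_le (α : ℝ) :
    ∃ C > 0, ∀ x : ℝ, 0 < x → x ≤ 1 / 2 →
      |(1 + (1 - α) * x / 2) * (1 + x) ^ α * (1 + gammaRatioCoeff α * x ^ 2) * (1 + x) ^ 2
        - (1 + (1 + α) * x / 2) * ((1 + x) ^ 2 + gammaRatioCoeff α * x ^ 2)| ≤ C * x ^ 4 := by
  obtain ⟨C, hC, h⟩ := exists_abs_one_add_rpow_sub_sum_le α 4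
  -- `q` is what remains, after division by x⁴, when (1 + x)^α is replaced by its cubic Taylor
  -- polynomial; `s` multiplies the Taylor remainder.
  set q : ℝ → ℝ := fun x => (1/4 * α - 11/24 * α ^ 2 + 1/4 * α ^ 3 - 1/24 * α ^ 4)
    + (19/48 * α - 247/288 * α ^ 2 + 29/48 * α ^ 3 - 5/36 * α ^ 4 - 1/288 * α ^ 6) * x
    + (1/6 * α - 31/72 * α ^ 2 + 101/288 * α ^ 3 - 11/144 * α ^ 4 - 1/72 * α ^ 5
      + 1/144 * α ^ 6 - 1/288 * α ^ 7) * x ^ 2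
    + (-5/288 * α ^ 2 + 5/144 * α ^ 3 - 1/144 * α ^ 4 - 1/36 * α ^ 5 + 7/288 * α ^ 6
      - 1/144 * α ^ 7) * x ^ 3
    + (-1/144 * α ^ 2 + 5/288 * α ^ 3 - 1/144 * α ^ 4 - 1/72 * α ^ 5 + 1/72 * α ^ 6
      - 1/288 * α ^ 7) * x ^ 4 with hq
  set s : ℝ → ℝ := fun x =>
    (1 + (1 - α) * x / 2) * (1 + gammaRatioCoeff α * x ^ 2) * (1 + x) ^ 2 with hs
  obtain ⟨A, hA⟩ := (isCompact_Icc (a := (0 : ℝ)) (b := 1 / 2)).exists_bound_of_continuousOn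
    (f := q) (by fun_prop)
  obtain ⟨B, hB⟩ := (isCompact_Icc (a := (0 : ℝ)) (b := 1 / 2)).exists_bound_of_continuousOn
    (f := s) (by fun_prop)
  refine ⟨|A| + |B| * C + 1, by positivity, fun x hx0 hx1 => ?_⟩
  have h1 := h x (by rw [abs_of_pos hx0]; exact hx1)
  simp only [Finset.sum_range_succ, Finset.range_zero, Finset.sum_empty, ringChoose_two,
    ringChoose_three, Ring.choose_zero_right, Ring.choose_one_right, abs_of_pos hx0] at h1
  set E := (1 + x) ^ α - (0 + 1 * x ^ 0 + α * x ^ 1 + α * (α - 1) / 2 * x ^ 2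
    + α * (α - 1) * (α - 2) / 6 * x ^ 3) with hE
  have e : (1 + (1 - α) * x / 2) * (1 + x) ^ α * (1 + gammaRatioCoeff α * x ^ 2) * (1 + x) ^ 2
        - (1 + (1 + α) * x / 2) * ((1 + x) ^ 2 + gammaRatioCoeff α * x ^ 2)
      = q x * x ^ 4 + s x * E := by
    simp only [hq, hs, hE, gammaRatioCoeff]
    ring
  rw [e]
  have hqx := hA x ⟨hx0.le, hx1⟩
  have hsx := hB x ⟨hx0.le, hx1⟩
  replace hqx : |q x| ≤ |A| := hqx.trans (le_abs_self A)
  replace hsx : |s x| ≤ |B| := hsx.trans (le_abs_self B)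
  calc |q x * x ^ 4 + s x * E| ≤ |q x * x ^ 4| + |s x * E| := abs_add_le _ _
    _ = |q x| * x ^ 4 + |s x| * |E| := by
        rw [abs_mul, abs_mul, abs_of_pos (by positivity : 0 < x ^ 4)]
    _ ≤ |A| * x ^ 4 + |B| * (C * x ^ 4) :=
        add_le_add (mul_le_mul_of_nonneg_right hqx (by positivity))
          (mul_le_mul hsx h1 (abs_nonneg _) (abs_nonneg _))
    _ ≤ _ := by nlinarith [show 0 < x ^ 4 by positivity]

/-- Euler's limit for Γ at 1 - α, whose product (1 - α)(2 - α)⋯(n + 1 - α) equals n! (n + 1 - α)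
g_n. -/
theorem tendsto_grunwaldSum {α : ℝ} (h1 : α < 1) :
    Tendsto (fun n : ℕ => Real.Gamma (1 - α) * grunwaldSum α n * (n + 1 - α) / (n : ℝ) ^ (1 - α))
      atTop (𝓝 1) := by
  have hG : Real.Gamma (1 - α) ≠ 0 := (Real.Gamma_pos_of_pos (by linarith)).ne'
  have hlim := (tendsto_const_nhds (x := Real.Gamma (1 - α))).div
    (Real.GammaSeq_tendsto_Gamma (1 - α)) hG
  rw [div_self hG] at hlim
  refine hlim.congr' ?_
  filter_upwards [eventually_gt_atTop 0] with n hn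
  have hprod : ∀ n : ℕ, ∏ j ∈ Finset.range (n + 1), (1 - α + (j : ℝ)) =
      n.factorial * ((n + 1 - α) * grunwaldSum α n) := by
    intro n
    induction n with
    | zero => simp [grunwaldSum_zero]
    | succ n ih =>
      rw [Finset.prod_range_succ, ih, Nat.factorial_succ, ← grunwaldSum_succ]
      push_cast
      ring
  have hn' : (0 : ℝ) < n := by exact_mod_cast hn
  have hpos : (0 : ℝ) < (n : ℝ) ^ (1 - α) := Real.rpow_pos_of_pos hn' _
  have hf : (0 : ℝ) < n.factorial := by positivity
  simp only [Pi.div_apply, Real.GammaSeq, hprod]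
  field_simp

theorem one_add_gammaRatioCoeff_div_sq_mem {α : ℝ} (h0 : 0 < α) (h1 : α < 1) {w : ℝ}
    (hw : 1 ≤ w) : 1 / 2 ≤ 1 + gammaRatioCoeff α / w ^ 2 ∧ 1 + gammaRatioCoeff α / w ^ 2 ≤ 1 := by
  have hk0 := gammaRatioCoeff_nonpos h0 h1
  have hk1 := neg_le_gammaRatioCoeff h0 h1
  have hw2 : 1 ≤ w ^ 2 := one_le_pow₀ hw
  constructor
  · have : -(1 / 2) ≤ gammaRatioCoeff α / w ^ 2 := by
      rw [le_div_iff₀ (by positivity)]; nlinarith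
    linarith
  · have : gammaRatioCoeff α / w ^ 2 ≤ 0 := div_nonpos_of_nonpos_of_nonneg hk0 (by positivity)
    linarith

/-- The quotient of `Γ(1 - α) ∑ w_n` by its second-order asymptotic expansion. -/
noncomputable def grunwaldSumQuotient (α : ℝ) (N : ℕ) : ℝ :=
  Real.Gamma (1 - α) * grunwaldSum α N * (N + (1 - α) / 2) ^ α /
    (1 + gammaRatioCoeff α / (N + (1 - α) / 2) ^ 2)

theorem grunwaldSumQuotient_pos {α : ℝ} (h0 : 0 < α) (h1 : α < 1) {N : ℕ} (hN : 2 ≤ N) :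
    0 < grunwaldSumQuotient α N := by
  have hΓ : 0 < Real.Gamma (1 - α) := Real.Gamma_pos_of_pos (by linarith)
  have hN' : (2 : ℝ) ≤ N := by exact_mod_cast hN
  have := (one_add_gammaRatioCoeff_div_sq_mem h0 h1
    (by linarith : 1 ≤ (N : ℝ) + (1 - α) / 2)).1
  have := grunwaldSum_pos h1 N
  have : 0 < (N + (1 - α) / 2) ^ α := Real.rpow_pos_of_pos (by linarith) _
  unfold grunwaldSumQuotient
  positivity

theorem tendsto_grunwaldSumQuotient {α : ℝ} (h1 : α < 1) :
    Tendsto (grunwaldSumQuotient α) atTop (𝓝 1) := by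
  set k := gammaRatioCoeff α with hk
  have hw : Tendsto (fun n : ℕ => (n : ℝ) + (1 - α) / 2) atTop atTop :=
    tendsto_atTop_add_const_right _ _ tendsto_natCast_atTop_atTop
  have l1 : Tendsto (fun n : ℕ => 1 + k / ((n : ℝ) + (1 - α) / 2) ^ 2) atTop (𝓝 1) := by
    simpa using ((tendsto_const_nhds (x := k)).div_atTop
      ((tendsto_pow_atTop (n := 2) (by norm_num)).comp hw)).const_add 1
  have l2 : ∀ c : ℝ, Tendsto (fun n : ℕ => ((n : ℝ) + c) / n) atTop (𝓝 1) := by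
    intro c
    have : Tendsto (fun n : ℕ => 1 + c / (n : ℝ)) atTop (𝓝 (1 + 0)) :=
      ((tendsto_const_nhds (x := c)).div_atTop tendsto_natCast_atTop_atTop).const_add 1
    rw [add_zero] at this
    refine this.congr' ?_
    filter_upwards [eventually_gt_atTop 0] with n hn
    have : (n : ℝ) ≠ 0 := by positivity
    field_simp
  have l3 := (l2 ((1 - α) / 2)).rpow_const (p := α) (Or.inl one_ne_zero)
  have l4 := (((tendsto_grunwaldSum h1).mul l3).div (l2 (1 - α)) one_ne_zero).div l1 one_ne_zero
  simp only [Real.one_rpow, mul_one, div_one] at l4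
  refine l4.congr' ?_
  filter_upwards [eventually_gt_atTop 0] with n hn
  have hn' : (0 : ℝ) < n := by exact_mod_cast hn
  simp only [grunwaldSumQuotient, Pi.div_apply]
  rw [Real.div_rpow (by linarith) hn'.le, Real.rpow_sub hn', Real.rpow_one,
    show (n : ℝ) + (1 - α) = n + 1 - α by ring]
  have : (0 : ℝ) < n + 1 - α := by linarith
  have : (0 : ℝ) < (n : ℝ) ^ α := Real.rpow_pos_of_pos hn' _
  congr 1
  field_simp

/-- The cross-multiplied ratio. In terms of w, the factor (N + 1 - α)/(N + 1) becomes (w + (1 -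
α)/2) / (w + (1 + α)/2). -/
theorem grunwaldSumQuotient_succ_mul {α : ℝ} (h0 : 0 < α) (h1 : α < 1) {N : ℕ}
    (hN : 2 ≤ N) {w : ℝ}
    (hw : w = N + (1 - α) / 2) :
    grunwaldSumQuotient α (N + 1) * ((1 + (1 + α) * (1 / w) / 2) *
        ((1 + 1 / w) ^ 2 + gammaRatioCoeff α * (1 / w) ^ 2)) =
      grunwaldSumQuotient α N * ((1 + (1 - α) * (1 / w) / 2) * (1 + 1 / w) ^ α *
        (1 + gammaRatioCoeff α * (1 / w) ^ 2) * (1 + 1 / w) ^ 2) := by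
  set k := gammaRatioCoeff α with hk
  have hN' : (2 : ℝ) ≤ N := by exact_mod_cast hN
  have hw0 : 0 < w := by linarith
  have d1 := (one_add_gammaRatioCoeff_div_sq_mem h0 h1 (by linarith : 1 ≤ w)).1
  have d2 := (one_add_gammaRatioCoeff_div_sq_mem h0 h1 (by linarith : 1 ≤ w + 1)).1
  rw [← hk] at d1 d2
  have hg : grunwaldSum α (N + 1) = (w + (1 - α) / 2) / (w + (1 + α) / 2) *
      grunwaldSum α N := by
    have := grunwaldSum_succ α N
    have h3 : 0 < w + (1 + α) / 2 := by positivity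
    field_simp
    rw [hw]
    linear_combination 2 * this
  have hp : (w + 1) ^ α = w ^ α * (1 + 1 / w) ^ α := by
    rw [← Real.mul_rpow hw0.le (by positivity)]
    congr 1
    field_simp
  have e1 : grunwaldSumQuotient α (N + 1) = Real.Gamma (1 - α) * grunwaldSum α (N + 1) * (w + 1) ^ α /
      (1 + k / (w + 1) ^ 2) := by
    simp only [grunwaldSumQuotient]
    rw [show ((N + 1 : ℕ) : ℝ) + (1 - α) / 2 = w + 1 by rw [hw]; push_cast; ring]
  have e2 : grunwaldSumQuotient α N = Real.Gamma (1 - α) * grunwaldSum α N * w ^ α / (1 + k / w ^ 2) := by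
    simp only [grunwaldSumQuotient]
    rw [hw]
  rw [e1, e2, hg, hp]
  have h3 : 0 < w + (1 + α) / 2 := by positivity
  have d1' : (1 + k / w ^ 2) ≠ 0 := by positivity
  have d2' : (1 + k / (w + 1) ^ 2) ≠ 0 := by positivity
  generalize (1 + 1 / w) ^ α = t
  have f1 : (1 + 1 / w) ^ 2 + k * (1 / w) ^ 2 = (w + 1) ^ 2 / w ^ 2 * (1 + k / (w + 1) ^ 2) := by
    field_simp
  have f2 : 1 + k * (1 / w) ^ 2 = 1 + k / w ^ 2 := by field_simp
  rw [f1, f2]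
  generalize 1 + k / (w + 1) ^ 2 = u at *
  generalize 1 + k / w ^ 2 = u' at *
  field_simp

theorem exists_abs_grunwaldSumQuotient_succ_sub_le {α : ℝ} (h0 : 0 < α) (h1 : α < 1) :
    ∃ C > 0, ∀ N : ℕ, 2 ≤ N →
      |grunwaldSumQuotient α (N + 1) - grunwaldSumQuotient α N| ≤
        C / (N + (1 - α) / 2) ^ 4 := by
  have hk1 := neg_le_gammaRatioCoeff h0 h1
  have hk0 := gammaRatioCoeff_nonpos h0 h1
  obtain ⟨B, hB⟩ : ∃ B, ∀ n, grunwaldSumQuotient α n ≤ B := by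
    obtain ⟨B, hB⟩ := (tendsto_grunwaldSumQuotient h1).bddAbove_range
    exact ⟨B, fun n => hB ⟨n, rfl⟩⟩
  have hBpos : 0 < B := (grunwaldSumQuotient_pos h0 h1 le_rfl).trans_le (hB 2)
  obtain ⟨C, hC, hstep⟩ := exists_abs_poly_mul_rpow_sub_le α
  -- `B` bounds the convergent sequence of quotients; the factor 2 comes from the lower bound 1/2
  -- for the denominator `Dn`.
  refine ⟨2 * B * C, by positivity, fun N hN => ?_⟩
  have hN' : (2 : ℝ) ≤ N := by exact_mod_cast hN
  obtain ⟨w, hw⟩ : ∃ w : ℝ, w = N + (1 - α) / 2 := ⟨_, rfl⟩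
  have hw2 : 2 ≤ w := by linarith
  have hw0 : 0 < w := by linarith
  have hs := hstep (1 / w) (by positivity) (by rw [div_le_div_iff₀] <;> linarith)
  have hratio := grunwaldSumQuotient_succ_mul h0 h1 hN hw
  have hρN := grunwaldSumQuotient_pos h0 h1 hN
  have hBN := hB N
  rw [← hw]
  generalize grunwaldSumQuotient α (N + 1) = ρ' at *
  generalize grunwaldSumQuotient α N = ρ at *
  generalize gammaRatioCoeff α = k at *
  set x := 1 / w with hx
  have hx0 : 0 < x := by positivity
  have hx1 : x ≤ 1 / 2 := by rw [hx, div_le_div_iff₀] <;> linarith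
  set Dn := (1 + (1 + α) * x / 2) * ((1 + x) ^ 2 + k * x ^ 2) with hDn
  set Nn := (1 + (1 - α) * x / 2) * (1 + x) ^ α * (1 + k * x ^ 2) * (1 + x) ^ 2 with hNn
  have hD : 1 / 2 ≤ Dn := by
    have a1 : 1 ≤ 1 + (1 + α) * x / 2 := by
      have : 0 ≤ (1 + α) * x / 2 := by positivity
      linarith
    have a2 : 1 / 2 ≤ (1 + x) ^ 2 + k * x ^ 2 := by nlinarith
    nlinarith
  have hdiff : (ρ' - ρ) * Dn = ρ * (Nn - Dn) := by linear_combination hratio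
  clear_value Dn Nn
  have habs := congrArg abs hdiff
  rw [abs_mul, abs_mul, abs_of_pos hρN, abs_of_pos (by linarith : 0 < Dn)] at habs
  have hub : ρ * |Nn - Dn| ≤ B * (C * x ^ 4) :=
    mul_le_mul (hBN) hs (abs_nonneg _) hBpos.le
  have hfin : |ρ' - ρ| ≤ 2 * (B * (C * x ^ 4)) := by
    nlinarith [abs_nonneg (ρ' - ρ)]
  refine hfin.trans (le_of_eq ?_)
  rw [hx]
  field_simp

/-- The increments of the quotient are O(w⁻⁴) and its limit is 1, so it is 1 + O(w⁻³). Multiplying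
back by 1 + k/w² ≤ 1 does not enlarge the error. Starting at N = 2 ensures 1/w ≤ 1/2. -/
theorem exists_abs_gammaRatio_sub_one_le {α : ℝ} (h0 : 0 < α) (h1 : α < 1) :
    ∃ C > 0, ∀ N : ℕ, 2 ≤ N →
      |Real.Gamma (1 - α) * grunwaldSum α N * (N + (1 - α) / 2) ^ α
        - (1 + gammaRatioCoeff α / (N + (1 - α) / 2) ^ 2)| ≤ C / (N + (1 - α) / 2) ^ 3 := by
  obtain ⟨C, hC, hρ4⟩ := exists_abs_grunwaldSumQuotient_succ_sub_le h0 h1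
  refine ⟨C, hC, fun N hN => ?_⟩
  have hN' : (2 : ℝ) ≤ N := by exact_mod_cast hN
  obtain ⟨n, rfl⟩ := Nat.exists_eq_add_of_le' hN
  have hmain := abs_sub_one_le_of_abs_sub_le (ρ := fun n => grunwaldSumQuotient α (n + 2))
    (w₀ := 2 + (1 - α) / 2) (C := C) (by linarith) hC.le
    ((tendsto_add_atTop_iff_nat 2).2 (tendsto_grunwaldSumQuotient h1)) (fun n => by
      have := hρ4 (n + 2) (by omega)
      rw [show n + 1 + 2 = n + 2 + 1 by ring]
      convert this using 3
      push_cast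
      ring) n
  have hcast : (2 + (1 - α) / 2 + (n : ℝ)) = ((n + 2 : ℕ) : ℝ) + (1 - α) / 2 := by
    push_cast; ring
  rw [hcast] at hmain
  obtain ⟨w, hw⟩ : ∃ w : ℝ, w = ((n + 2 : ℕ) : ℝ) + (1 - α) / 2 := ⟨_, rfl⟩
  have hd := one_add_gammaRatioCoeff_div_sq_mem h0 h1 (w := w) (by linarith)
  have e : Real.Gamma (1 - α) * grunwaldSum α (n + 2) * w ^ α - (1 + gammaRatioCoeff α / w ^ 2) =
      (grunwaldSumQuotient α (n + 2) - 1) * (1 + gammaRatioCoeff α / w ^ 2) := by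
    have : 1 + gammaRatioCoeff α / w ^ 2 ≠ 0 := by linarith
    simp only [grunwaldSumQuotient]
    rw [← hw, sub_mul, div_mul_cancel₀ _ this, one_mul]
  rw [← hw] at hmain ⊢
  rw [e, abs_mul, abs_of_pos (by linarith : 0 < 1 + gammaRatioCoeff α / w ^ 2)]
  exact (mul_le_of_le_one_right (abs_nonneg _) hd.2).trans hmain

/-! ### Expansion of the closed forms in powers of 1/w -/

theorem exists_abs_le_of_continuous_uncurry {f : ℝ → ℝ → ℝ} (hf : Continuous (Function.uncurry f)) :
    ∃ C > 0, ∀ x τ : ℝ, 0 < x → x ≤ 1 / 2 → |τ| ≤ 1 / 2 → |f x τ| ≤ C := by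
  obtain ⟨C, hC⟩ := ((isCompact_Icc (a := (0 : ℝ)) (b := 1 / 2)).prod
    (isCompact_Icc (a := -(1 / 2 : ℝ)) (b := 1 / 2))).exists_bound_of_continuousOn hf.continuousOn
  refine ⟨|C| + 1, by positivity, fun x τ hx0 hx1 hτ => ?_⟩
  have := hC (x, τ) ⟨⟨hx0.le, hx1⟩, abs_le.1 hτ⟩
  rw [Real.norm_eq_abs] at this
  have h2 := le_abs_self C
  simp only [Function.uncurry] at this
  linarith

theorem exists_abs_one_add_mul_rpow_sub_sum_le (γ : ℝ) (n : ℕ) :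
    ∃ C > 0, ∀ x τ : ℝ, 0 < x → x ≤ 1 / 2 → |τ| ≤ 1 / 2 →
      |(1 + τ * x) ^ γ - ∑ k ∈ Finset.range n, Ring.choose γ k * (τ * x) ^ k| ≤ C * x ^ n := by
  obtain ⟨C, hC, h⟩ := exists_abs_one_add_rpow_sub_sum_le γ n
  refine ⟨C, hC, fun x τ hx0 hx1 hτ => ?_⟩
  have hle : |τ * x| ≤ x := by
    rw [abs_mul, abs_of_pos hx0]
    nlinarith [abs_nonneg τ]
  refine (h (τ * x) (hle.trans hx1)).trans ?_
  gcongr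

/-- The polynomial `cubicGrunwaldPoly` in the variables `x = (N + (1 - α) / 2)⁻¹` and
`τ = θ - 1 / 2`. -/
noncomputable def cubicGrunwaldSymbol (α x τ : ℝ) : ℝ :=
  1 + (3 - α) * τ * x
    + (7 / 24 * α - 5 / 24 * α ^ 2 + (3 - 5 / 2 * α + 1 / 2 * α ^ 2) * τ ^ 2) * x ^ 2
    + ((3 / 8 * α - 1 / 2 * α ^ 2 + 1 / 8 * α ^ 3) * τ
      + (1 - 11 / 6 * α + α ^ 2 - 1 / 6 * α ^ 3) * τ ^ 3) * x ^ 3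

/-- The polynomial `quarticGrunwaldPoly` in the variables `x = (N + (1 - α) / 2)⁻¹` and
`τ = θ - 1 / 2`. -/
noncomputable def quarticGrunwaldSymbol (α x τ : ℝ) : ℝ :=
  1 + (4 - α) * τ * x
    + (13 / 24 * α - 7 / 24 * α ^ 2 + (6 - 7 / 2 * α + 1 / 2 * α ^ 2) * τ ^ 2) * x ^ 2
    + ((7 / 6 * α - 9 / 8 * α ^ 2 + 5 / 24 * α ^ 3) * τ
      + (4 - 13 / 3 * α + 3 / 2 * α ^ 2 - 1 / 6 * α ^ 3) * τ ^ 3) * x ^ 3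
    + (-1 / 64 * α + 23 / 384 * α ^ 2 - 11 / 192 * α ^ 3 + 5 / 384 * α ^ 4
      + (3 / 4 * α - 19 / 16 * α ^ 2 + 1 / 2 * α ^ 3 - 1 / 16 * α ^ 4) * τ ^ 2
      + (1 - 25 / 12 * α + 35 / 24 * α ^ 2 - 5 / 12 * α ^ 3 + 1 / 24 * α ^ 4) * τ ^ 4) * x ^ 4

theorem cubicGrunwaldPoly_eq {α w τ N θ : ℝ} (hw : w ≠ 0) (hN : N = w - (1 - α) / 2)
    (hθ : θ = τ + 1 / 2) :
    cubicGrunwaldPoly α N θ = 6 * (w ^ 3 * cubicGrunwaldSymbol α (1 / w) τ) := by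
  subst hN hθ
  unfold cubicGrunwaldPoly cubicGrunwaldSymbol
  field_simp
  ring

theorem quarticGrunwaldPoly_eq {α w τ N θ : ℝ} (hw : w ≠ 0) (hN : N = w - (1 - α) / 2)
    (hθ : θ = τ + 1 / 2) :
    quarticGrunwaldPoly α N θ = 24 * (w ^ 4 * quarticGrunwaldSymbol α (1 / w) τ) := by
  subst hN hθ
  unfold quarticGrunwaldPoly quarticGrunwaldSymbol
  field_simp
  ring

/-- The symbol and (1 + τx)^(3-α) share the terms 1 + (3 - α)τx; everything else carries a factor
x². -/
theorem exists_abs_cubic_expansion_le (α : ℝ) {A : ℝ} (hA : 0 < A) :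
    ∃ C > 0, ∀ x τ e : ℝ, 0 < x → x ≤ 1 / 2 → |τ| ≤ 1 / 2 → |e| ≤ A * x ^ 3 →
      |(1 + gammaRatioCoeff α * x ^ 2 + e) * cubicGrunwaldSymbol α x τ - (1 + τ * x) ^ (3 - α)|
        ≤ C * x ^ 2 := by
  obtain ⟨C₁, hC₁, h₁⟩ := exists_abs_one_add_mul_rpow_sub_sum_le (3 - α) 2
  obtain ⟨C₂, hC₂, h₂⟩ := exists_abs_le_of_continuous_uncurry (f := cubicGrunwaldSymbol α) (by
    unfold cubicGrunwaldSymbol Function.uncurry; fun_prop)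
  set r : ℝ → ℝ → ℝ := fun x τ =>
    7 / 24 * α - 5 / 24 * α ^ 2 + (3 - 5 / 2 * α + 1 / 2 * α ^ 2) * τ ^ 2
    + ((3 / 8 * α - 1 / 2 * α ^ 2 + 1 / 8 * α ^ 3) * τ
      + (1 - 11 / 6 * α + α ^ 2 - 1 / 6 * α ^ 3) * τ ^ 3) * x
    + gammaRatioCoeff α * cubicGrunwaldSymbol α x τ with hr
  obtain ⟨C₃, hC₃, h₃⟩ := exists_abs_le_of_continuous_uncurry (f := r) (by
    simp only [hr]; unfold cubicGrunwaldSymbol Function.uncurry; fun_prop)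
  refine ⟨C₃ + A * C₂ + C₁, by positivity, fun x τ e hx0 hx1 hτ he => ?_⟩
  have b₁ := h₁ x τ hx0 hx1 hτ
  simp only [Finset.sum_range_succ, Finset.range_zero, Finset.sum_empty,
    Ring.choose_zero_right, Ring.choose_one_right] at b₁
  set E := (1 + τ * x) ^ (3 - α) - (0 + 1 * (τ * x) ^ 0 + (3 - α) * (τ * x) ^ 1) with hE
  have key : (1 + gammaRatioCoeff α * x ^ 2 + e) * cubicGrunwaldSymbol α x τ
      - (1 + τ * x) ^ (3 - α) = r x τ * x ^ 2 + e * cubicGrunwaldSymbol α x τ - E := by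
    simp only [hE, hr]
    unfold cubicGrunwaldSymbol
    ring
  rw [key]
  have he' : |e * cubicGrunwaldSymbol α x τ| ≤ A * x ^ 2 * C₂ := by
    rw [abs_mul]
    refine mul_le_mul (he.trans ?_) (h₂ x τ hx0 hx1 hτ) (abs_nonneg _) (by positivity)
    gcongr A * ?_
    exact pow_le_pow_of_le_one hx0.le (by linarith) (by norm_num)
  have hr' : |r x τ * x ^ 2| ≤ C₃ * x ^ 2 := by
    rw [abs_mul, abs_of_pos (by positivity : 0 < x ^ 2)]
    exact mul_le_mul_of_nonneg_right (h₃ x τ hx0 hx1 hτ) (by positivity)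
  have t₁ := abs_sub (r x τ * x ^ 2 + e * cubicGrunwaldSymbol α x τ) E
  have t₂ := abs_add_le (r x τ * x ^ 2) (e * cubicGrunwaldSymbol α x τ)
  linarith

/-- Here the x² terms matter. Their τ² parts agree, both being (4 - α)(3 - α)/2. The τ-free part,
including `gammaRatioCoeff`, is α(12 - 7α + α²)/24 = (α/24)(4 - α)(3 - α), which is the source of
the constant α/24. -/
theorem exists_abs_quartic_expansion_le (α : ℝ) {A : ℝ} (hA : 0 < A) :
    ∃ C > 0, ∀ x τ e : ℝ, 0 < x → x ≤ 1 / 2 → |τ| ≤ 1 / 2 → |e| ≤ A * x ^ 3 →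
      |(1 + gammaRatioCoeff α * x ^ 2 + e) * quarticGrunwaldSymbol α x τ
        - (1 + τ * x) ^ (4 - α)
        - α / 24 * ((4 - α) * (3 - α)) * x ^ 2 * (1 + τ * x) ^ (2 - α)| ≤ C * x ^ 3 := by
  obtain ⟨C₁, hC₁, h₁⟩ := exists_abs_one_add_mul_rpow_sub_sum_le (4 - α) 3
  obtain ⟨C₄, hC₄, h₄⟩ := exists_abs_one_add_mul_rpow_sub_sum_le (2 - α) 1
  obtain ⟨C₂, hC₂, h₂⟩ := exists_abs_le_of_continuous_uncurry (f := quarticGrunwaldSymbol α) (by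
    unfold quarticGrunwaldSymbol Function.uncurry; fun_prop)
  set s : ℝ → ℝ → ℝ := fun x τ => ((7 / 6 * α - 9 / 8 * α ^ 2 + 5 / 24 * α ^ 3) * τ
      + (4 - 13 / 3 * α + 3 / 2 * α ^ 2 - 1 / 6 * α ^ 3) * τ ^ 3)
    + (-1 / 64 * α + 23 / 384 * α ^ 2 - 11 / 192 * α ^ 3 + 5 / 384 * α ^ 4
      + (3 / 4 * α - 19 / 16 * α ^ 2 + 1 / 2 * α ^ 3 - 1 / 16 * α ^ 4) * τ ^ 2
      + (1 - 25 / 12 * α + 35 / 24 * α ^ 2 - 5 / 12 * α ^ 3 + 1 / 24 * α ^ 4) * τ ^ 4) * x with hs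
  set r : ℝ → ℝ → ℝ := fun x τ => s x τ + gammaRatioCoeff α * ((4 - α) * τ
    + (13 / 24 * α - 7 / 24 * α ^ 2 + (6 - 7 / 2 * α + 1 / 2 * α ^ 2) * τ ^ 2) * x
    + s x τ * x ^ 2) with hr
  obtain ⟨C₃, hC₃, h₃⟩ := exists_abs_le_of_continuous_uncurry (f := r) (by
    simp only [hr, hs]; unfold Function.uncurry; fun_prop)
  set B := |α / 24 * ((4 - α) * (3 - α))| with hB
  refine ⟨C₃ + A * C₂ + C₁ + B * C₄, by positivity, fun x τ e hx0 hx1 hτ he => ?_⟩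
  have b₁ := h₁ x τ hx0 hx1 hτ
  have b₄ := h₄ x τ hx0 hx1 hτ
  simp only [Finset.sum_range_succ, Finset.range_zero, Finset.sum_empty,
    Ring.choose_zero_right, Ring.choose_one_right, ringChoose_two] at b₁ b₄
  set E := (1 + τ * x) ^ (4 - α) - (0 + 1 * (τ * x) ^ 0 + (4 - α) * (τ * x) ^ 1
    + (4 - α) * (4 - α - 1) / 2 * (τ * x) ^ 2) with hE
  set E' := (1 + τ * x) ^ (2 - α) - (0 + 1 * (τ * x) ^ 0) with hE'
  have key : (1 + gammaRatioCoeff α * x ^ 2 + e) * quarticGrunwaldSymbol α x τ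
        - (1 + τ * x) ^ (4 - α)
        - α / 24 * ((4 - α) * (3 - α)) * x ^ 2 * (1 + τ * x) ^ (2 - α) =
      r x τ * x ^ 3 + e * quarticGrunwaldSymbol α x τ - E
        - α / 24 * ((4 - α) * (3 - α)) * (x ^ 2 * E') := by
    simp only [hE, hE', hr, hs]
    unfold quarticGrunwaldSymbol gammaRatioCoeff
    ring
  rw [key]
  have he' : |e * quarticGrunwaldSymbol α x τ| ≤ A * x ^ 3 * C₂ := by
    rw [abs_mul]
    exact mul_le_mul he (h₂ x τ hx0 hx1 hτ) (abs_nonneg _) (by positivity)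
  have hr' : |r x τ * x ^ 3| ≤ C₃ * x ^ 3 := by
    rw [abs_mul, abs_of_pos (by positivity : 0 < x ^ 3)]
    exact mul_le_mul_of_nonneg_right (h₃ x τ hx0 hx1 hτ) (by positivity)
  have hE2 : |α / 24 * ((4 - α) * (3 - α)) * (x ^ 2 * E')| ≤ B * (x ^ 2 * (C₄ * x ^ 1)) := by
    rw [abs_mul, abs_mul (x ^ 2), abs_of_pos (by positivity : 0 < x ^ 2)]
    gcongr
  have t₀ := abs_sub (r x τ * x ^ 3 + e * quarticGrunwaldSymbol α x τ - E)
    (α / 24 * ((4 - α) * (3 - α)) * (x ^ 2 * E'))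
  have t₁ := abs_sub (r x τ * x ^ 3 + e * quarticGrunwaldSymbol α x τ) E
  have t₂ := abs_add_le (r x τ * x ^ 3) (e * quarticGrunwaldSymbol α x τ)
  have : B * (x ^ 2 * (C₄ * x ^ 1)) = B * C₄ * x ^ 3 := by ring
  linarith

/-! ### Truncated powers and the kernel estimates -/

/-- The truncated power `t₊ ^ γ / Γ(γ + 1)`. -/
noncomputable def truncPower (γ t : ℝ) : ℝ := max t 0 ^ γ / Real.Gamma (γ + 1)

theorem truncPower_of_nonpos {γ t : ℝ} (hγ : γ ≠ 0) (ht : t ≤ 0) : truncPower γ t = 0 := by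
  simp [truncPower, max_eq_right ht, Real.zero_rpow hγ]

theorem truncPower_of_nonneg {γ t : ℝ} (ht : 0 ≤ t) :
    truncPower γ t = t ^ γ / Real.Gamma (γ + 1) := by
  simp [truncPower, max_eq_left ht]

theorem truncPower_nonneg {γ : ℝ} (hγ : 0 ≤ γ) (t : ℝ) : 0 ≤ truncPower γ t := by
  have := Real.Gamma_pos_of_pos (by linarith : 0 < γ + 1)
  exact div_nonneg (Real.rpow_nonneg (le_max_right _ _) _) this.le

theorem truncPower_mono {γ : ℝ} (hγ : 0 ≤ γ) : Monotone (truncPower γ) := by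
  intro s t hst
  have := Real.Gamma_pos_of_pos (by linarith : 0 < γ + 1)
  exact div_le_div_of_nonneg_right (Real.rpow_le_rpow (le_max_right _ _)
    (max_le_max_right 0 hst) hγ) this.le

theorem truncPower_mul {γ h : ℝ} (hh : 0 < h) (t : ℝ) :
    truncPower γ (h * t) = h ^ γ * truncPower γ t := by
  unfold truncPower
  rw [show max (h * t) 0 = h * max t 0 by rw [mul_max_of_nonneg _ _ hh.le, mul_zero],
    Real.mul_rpow hh.le (le_max_right _ _), mul_div_assoc]

theorem continuous_truncPower {γ : ℝ} (hγ : 0 ≤ γ) : Continuous (truncPower γ) := by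
  unfold truncPower
  exact ((continuous_id.max continuous_const).rpow_const fun _ => Or.inr hγ).div_const _

theorem hasDerivAt_truncPower {γ : ℝ} (hγ : 1 < γ) (t : ℝ) :
    HasDerivAt (truncPower γ) (truncPower (γ - 1) t) t := by
  have hG : Real.Gamma (γ + 1) = γ * Real.Gamma γ := Real.Gamma_add_one (by linarith)
  have hG0 := Real.Gamma_pos_of_pos (by linarith : 0 < γ)
  have hval : ∀ s : ℝ, 0 ≤ s → truncPower (γ - 1) s = γ * s ^ (γ - 1) / Real.Gamma (γ + 1) := by
    intro s hs
    rw [truncPower_of_nonneg hs, hG, sub_add_cancel]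
    field_simp
  have hright : ∀ s : ℝ, 0 ≤ s →
      HasDerivAt (fun t : ℝ => t ^ γ / Real.Gamma (γ + 1)) (truncPower (γ - 1) s) s := by
    intro s hs
    rw [hval s hs]
    exact (Real.hasDerivAt_rpow_const (Or.inr hγ.le)).div_const _
  rcases lt_trichotomy t 0 with ht | rfl | ht
  · rw [truncPower_of_nonpos (by linarith) ht.le]
    refine (hasDerivAt_const t (0 : ℝ)).congr_of_eventuallyEq ?_
    filter_upwards [Iio_mem_nhds ht] with s hs
    exact truncPower_of_nonpos (by linarith) (le_of_lt hs)
  · rw [← hasDerivWithinAt_univ, ← Iic_union_Ici (a := (0 : ℝ))]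
    refine HasDerivWithinAt.union ?_ ?_
    · rw [truncPower_of_nonpos (by linarith) le_rfl]
      exact (hasDerivWithinAt_const 0 _ (0 : ℝ)).congr
        (fun s hs => truncPower_of_nonpos (by linarith) hs)
        (truncPower_of_nonpos (by linarith) le_rfl)
    · exact (hright 0 le_rfl).hasDerivWithinAt.congr
        (fun s hs => truncPower_of_nonneg hs) (truncPower_of_nonneg le_rfl)
  · refine (hright t ht.le).congr_of_eventuallyEq ?_
    filter_upwards [Ioi_mem_nhds ht] with s hs
    exact truncPower_of_nonneg (le_of_lt hs)

/-- Terms with n > v vanish, so the cut-off L is immaterial once it exceeds v. -/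
theorem sum_grunwaldWeight_mul_truncPower_eq {α γ v : ℝ} (hγ : γ ≠ 0) {L : ℕ} (hv : 0 ≤ v)
    (hL : v < L) :
    ∑ n ∈ Finset.range L, grunwaldWeight α n * truncPower γ (v - n) =
      ∑ n ∈ Finset.range (⌊v⌋₊ + 1), grunwaldWeight α n * truncPower γ (v - n) := by
  symm
  apply Finset.sum_subset
  · intro n hn
    rw [Finset.mem_range] at *
    have : ⌊v⌋₊ < L := (Nat.floor_lt hv).2 hL
    omega
  · intro n _ hn
    rw [Finset.mem_range, not_lt] at hn
    have h1 := (Nat.floor_lt hv).1 (by omega : ⌊v⌋₊ < n)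
    rw [truncPower_of_nonpos hγ (by linarith), mul_zero]

/-- Covers the bounded range where the asymptotics in 1/w are not available: at most two terms
survive, with weights at most 1 in absolute value. -/
theorem abs_sum_grunwaldWeight_mul_truncPower_le {α γ v : ℝ} (h0 : 0 < α) (h1 : α < 1)
    (hγ : 0 < γ) {L : ℕ} (hv0 : 0 ≤ v) (hv : v < 2) (hL : v < L) :
    |∑ n ∈ Finset.range L, grunwaldWeight α n * truncPower γ (v - n)| ≤ 2 * truncPower γ 2 := by
  rw [sum_grunwaldWeight_mul_truncPower_eq hγ.ne' hv0 hL]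
  have hN : ⌊v⌋₊ < 2 := (Nat.floor_lt hv0).2 (by exact_mod_cast hv)
  have hT := truncPower_nonneg hγ.le 2
  calc |∑ n ∈ Finset.range (⌊v⌋₊ + 1), grunwaldWeight α n * truncPower γ (v - n)|
      ≤ ∑ n ∈ Finset.range (⌊v⌋₊ + 1), |grunwaldWeight α n * truncPower γ (v - n)| :=
        Finset.abs_sum_le_sum_abs _ _
    _ ≤ ∑ n ∈ Finset.range (⌊v⌋₊ + 1), truncPower γ 2 := by
        apply Finset.sum_le_sum
        intro n _
        rw [abs_mul, abs_of_nonneg (truncPower_nonneg hγ.le _)]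
        have hn : (0 : ℝ) ≤ n := n.cast_nonneg
        have := truncPower_mono hγ.le (by linarith : v - n ≤ 2)
        calc |grunwaldWeight α n| * truncPower γ (v - n) ≤ 1 * truncPower γ 2 :=
              mul_le_mul (abs_grunwaldWeight_le_one h0 h1 n) this (truncPower_nonneg hγ.le _)
                zero_le_one
          _ = _ := one_mul _
    _ = (⌊v⌋₊ + 1) * truncPower γ 2 := by simp
    _ ≤ 2 * truncPower γ 2 := by
        gcongr
        have : (⌊v⌋₊ : ℝ) ≤ 1 := by exact_mod_cast (by omega : ⌊v⌋₊ ≤ 1)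
        linarith

/-- Writing `v = N + θ`, `w = N + (1 - α) / 2` and `τ = θ - 1 / 2`, with `2 ≤ N`. -/
theorem exists_floor_decomposition {α v : ℝ} (h0 : 0 < α) (h1 : α < 1) (hv : 2 ≤ v) :
    ∃ w τ : ℝ, 2 ≤ ⌊v⌋₊ ∧ w = ⌊v⌋₊ + (1 - α) / 2 ∧ v = ⌊v⌋₊ + (τ + 1 / 2) ∧ |τ| ≤ 1 / 2 ∧
      2 ≤ w ∧ w ≤ 1 + v ∧ w + τ = v - α / 2 := by
  have a1 := Nat.floor_le (by linarith : 0 ≤ v)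
  have a2 := Nat.lt_floor_add_one v
  have a3 : 2 ≤ ⌊v⌋₊ := Nat.le_floor (by exact_mod_cast hv)
  have a4 : (2 : ℝ) ≤ ⌊v⌋₊ := by exact_mod_cast a3
  refine ⟨⌊v⌋₊ + (1 - α) / 2, v - ⌊v⌋₊ - 1 / 2, a3, rfl, by ring, ?_, by linarith, by linarith,
    by ring⟩
  rw [abs_le]
  constructor <;> linarith

theorem rpow_add_eq {w τ γ : ℝ} (hw : 2 ≤ w) (hτ : |τ| ≤ 1 / 2) :
    (w + τ) ^ γ = w ^ γ * (1 + τ * (1 / w)) ^ γ := by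
  have hw0 : 0 < w := by linarith
  have := abs_le.1 hτ
  have h2 : 0 ≤ 1 + τ * (1 / w) := by
    have : 1 + τ * (1 / w) = (w + τ) / w := by field_simp
    rw [this]
    apply div_nonneg <;> linarith
  rw [← Real.mul_rpow hw0.le h2]
  congr 1
  field_simp

/-- For v < 0 everything vanishes and for v < 2 everything is bounded. For v ≥ 2 the closed form and
the asymptotics leave an error w^(3-α) O(w⁻²) = O(w^(1-α)), with w ≤ 1 + v. -/
theorem exists_abs_sum_grunwaldWeight_mul_truncPower_three_sub_le {α : ℝ} (h0 : 0 < α)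
    (h1 : α < 1) :
    ∃ C > 0, ∀ (v : ℝ) (L : ℕ), v < L →
      |∑ n ∈ Finset.range L, grunwaldWeight α n * truncPower 3 (v - n)
        - truncPower (3 - α) (v - α / 2)| ≤ C * (1 + max v 0) ^ (1 - α) := by
  obtain ⟨A, hA, hasum⟩ := exists_abs_gammaRatio_sub_one_le h0 h1
  obtain ⟨C, hC, hexp⟩ := exists_abs_cubic_expansion_le α hA
  have hT3 := truncPower_nonneg (by norm_num : (0 : ℝ) ≤ 3) 2
  have hTa := truncPower_nonneg (by linarith : 0 ≤ 3 - α) 2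
  have hΓ := Real.Gamma_pos_of_pos (by linarith : 0 < 1 - α)
  have hΓ4 : Real.Gamma (3 - α + 1) = (1 - α) * (2 - α) * (3 - α) * Real.Gamma (1 - α) := by
    rw [Real.Gamma_add_one (by linarith), show 3 - α = 2 - α + 1 by ring,
      Real.Gamma_add_one (by linarith), show 2 - α = 1 - α + 1 by ring,
      Real.Gamma_add_one (by linarith)]
    ring
  have hΓ4pos := Real.Gamma_pos_of_pos (by linarith : 0 < 3 - α + 1)
  refine ⟨2 * truncPower 3 2 + truncPower (3 - α) 2 + C / Real.Gamma (3 - α + 1), by positivity,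
    fun v L hL => ?_⟩
  have hone : 1 ≤ (1 + max v 0) ^ (1 - α) :=
    Real.one_le_rpow (by linarith [le_max_right v 0]) (by linarith)
  have hCG : 0 ≤ C / Real.Gamma (3 - α + 1) := by positivity
  rcases lt_or_ge v 0 with hv | hv
  · have : ∀ n : ℕ, truncPower 3 (v - n) = 0 := fun n =>
      truncPower_of_nonpos (by norm_num) (by linarith [(n.cast_nonneg : (0 : ℝ) ≤ n)])
    simp only [this, mul_zero, Finset.sum_const_zero]
    rw [truncPower_of_nonpos (by linarith) (by linarith), sub_zero, abs_zero]
    positivity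
  rcases lt_or_ge v 2 with hv2 | hv2
  · have b1 := abs_sum_grunwaldWeight_mul_truncPower_le h0 h1 (by norm_num : (0 : ℝ) < 3) hv hv2 hL
    have b2 := truncPower_mono (by linarith : 0 ≤ 3 - α) (by linarith : v - α / 2 ≤ 2)
    have b3 := truncPower_nonneg (by linarith : 0 ≤ 3 - α) (v - α / 2)
    have b4 := abs_sub (∑ n ∈ Finset.range L, grunwaldWeight α n * truncPower 3 (v - n))
      (truncPower (3 - α) (v - α / 2))
    rw [abs_of_nonneg b3] at b4
    nlinarith
  · rw [sum_grunwaldWeight_mul_truncPower_eq (by norm_num) hv hL]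
    obtain ⟨w, τ, hN, hw, hvτ, hτ, hw2, hwv, hwτ⟩ := exists_floor_decomposition h0 h1 hv2
    have hw0 : 0 < w := by linarith
    have ha := hasum ⌊v⌋₊ hN
    have hs := sum_grunwaldWeight_mul_cube α ⌊v⌋₊ (τ + 1 / 2)
    rw [cubicGrunwaldPoly_eq hw0.ne' (by linarith : (⌊v⌋₊ : ℝ) = w - (1 - α) / 2) rfl] at hs
    have hsum : Real.Gamma (3 - α + 1) *
        ∑ n ∈ Finset.range (⌊v⌋₊ + 1), grunwaldWeight α n * truncPower 3 (v - n) =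
        Real.Gamma (1 - α) * grunwaldSum α ⌊v⌋₊ *
          (w ^ 3 * cubicGrunwaldSymbol α (1 / w) τ) := by
      have e : ∀ n ∈ Finset.range (⌊v⌋₊ + 1), grunwaldWeight α n * truncPower 3 (v - n) =
          grunwaldWeight α n * (⌊v⌋₊ - n + (τ + 1 / 2)) ^ 3 * (1 / 6) := by
        intro n hn
        rw [Finset.mem_range] at hn
        have hn' : (n : ℝ) ≤ ⌊v⌋₊ := by exact_mod_cast (by omega : n ≤ ⌊v⌋₊)
        have hfl := Nat.floor_le hv
        rw [truncPower_of_nonneg (by linarith), show (v : ℝ) - n = ⌊v⌋₊ - n + (τ + 1 / 2) by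
          linarith, show (3 : ℝ) + 1 = ((3 : ℕ) : ℝ) + 1 by norm_num,
          Real.Gamma_nat_eq_factorial]
        norm_num [Nat.factorial]
        ring_nf
      rw [Finset.sum_congr rfl e, ← Finset.sum_mul, hΓ4]
      linear_combination (Real.Gamma (1 - α) / 6) * hs
    rw [← hw] at ha
    set ε := Real.Gamma (1 - α) * grunwaldSum α ⌊v⌋₊ * w ^ α
      - (1 + gammaRatioCoeff α / w ^ 2) with hε
    have hx := hexp (1 / w) τ ε (by positivity) (by rw [div_le_div_iff₀] <;> linarith) hτ
      (ha.trans (le_of_eq (by field_simp)))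
    have hwα : w ^ (3 - α) * w ^ α = w ^ 3 := by
      rw [← Real.rpow_add hw0, sub_add_cancel]
      exact_mod_cast Real.rpow_natCast w 3
    have hwx : w ^ (3 - α) * (1 / w) ^ 2 = w ^ (1 - α) := by
      rw [show 3 - α = 1 - α + (2 : ℕ) by push_cast; ring, Real.rpow_add_natCast hw0.ne']
      field_simp
    have hmain : Real.Gamma (3 - α + 1) *
        (∑ n ∈ Finset.range (⌊v⌋₊ + 1), grunwaldWeight α n * truncPower 3 (v - n)
          - truncPower (3 - α) (v - α / 2)) =
        w ^ (3 - α) * ((1 + gammaRatioCoeff α * (1 / w) ^ 2 + ε) *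
          cubicGrunwaldSymbol α (1 / w) τ - (1 + τ * (1 / w)) ^ (3 - α)) := by
      rw [mul_sub, hsum, truncPower_of_nonneg (by linarith), mul_div_cancel₀ _ hΓ4pos.ne', ← hwτ,
        rpow_add_eq hw2 hτ]
      have : 1 + gammaRatioCoeff α * (1 / w) ^ 2 + ε =
          Real.Gamma (1 - α) * grunwaldSum α ⌊v⌋₊ * w ^ α := by
        rw [hε]
        ring
      rw [this]
      linear_combination (-Real.Gamma (1 - α) * grunwaldSum α ⌊v⌋₊ *
        cubicGrunwaldSymbol α (1 / w) τ) * hwα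
    have habs := congrArg abs hmain
    rw [abs_mul, abs_mul, abs_of_pos hΓ4pos, abs_of_pos (Real.rpow_pos_of_pos hw0 _)] at habs
    have hle : w ^ (3 - α) * (C * (1 / w) ^ 2) ≤ C * (1 + max v 0) ^ (1 - α) := by
      rw [mul_left_comm, hwx, max_eq_left hv]
      gcongr
    have h5 := (habs.le.trans (mul_le_mul_of_nonneg_left hx (by positivity))).trans hle
    rw [← le_div_iff₀' hΓ4pos] at h5
    refine h5.trans ?_
    rw [mul_div_right_comm]
    gcongr
    linarith

theorem exists_abs_sum_grunwaldWeight_mul_truncPower_four_sub_le {α : ℝ} (h0 : 0 < α)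
    (h1 : α < 1) :
    ∃ C > 0, ∀ (v : ℝ) (L : ℕ), v < L →
      |∑ n ∈ Finset.range L, grunwaldWeight α n * truncPower 4 (v - n)
        - truncPower (4 - α) (v - α / 2) - α / 24 * truncPower (2 - α) (v - α / 2)| ≤
        C * (1 + max v 0) ^ (1 - α) := by
  obtain ⟨A, hA, hasum⟩ := exists_abs_gammaRatio_sub_one_le h0 h1
  obtain ⟨C, hC, hexp⟩ := exists_abs_quartic_expansion_le α hA
  have hT4 := truncPower_nonneg (by norm_num : (0 : ℝ) ≤ 4) 2
  have hTa := truncPower_nonneg (by linarith : 0 ≤ 4 - α) 2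
  have hTb := truncPower_nonneg (by linarith : 0 ≤ 2 - α) 2
  have hΓ := Real.Gamma_pos_of_pos (by linarith : 0 < 1 - α)
  have hΓ3 : Real.Gamma (4 - α + 1) = (4 - α) * (3 - α) * Real.Gamma (2 - α + 1) := by
    rw [Real.Gamma_add_one (by linarith), show 4 - α = 3 - α + 1 by ring,
      Real.Gamma_add_one (by linarith), show 3 - α = 2 - α + 1 by ring]
    ring
  have hΓ4 : Real.Gamma (4 - α + 1) =
      (1 - α) * (2 - α) * (3 - α) * (4 - α) * Real.Gamma (1 - α) := by
    rw [hΓ3, Real.Gamma_add_one (by linarith), show 2 - α = 1 - α + 1 by ring,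
      Real.Gamma_add_one (by linarith)]
    ring
  have hΓ3pos := Real.Gamma_pos_of_pos (by linarith : 0 < 2 - α + 1)
  have hΓ4pos := Real.Gamma_pos_of_pos (by linarith : 0 < 4 - α + 1)
  refine ⟨2 * truncPower 4 2 + truncPower (4 - α) 2 + α / 24 * truncPower (2 - α) 2 + C / Real.Gamma (4 - α + 1), by positivity,
    fun v L hL => ?_⟩
  have hone : 1 ≤ (1 + max v 0) ^ (1 - α) :=
    Real.one_le_rpow (by linarith [le_max_right v 0]) (by linarith)
  have hCG : 0 ≤ C / Real.Gamma (4 - α + 1) := by positivity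
  rcases lt_or_ge v 0 with hv | hv
  · have : ∀ n : ℕ, truncPower 4 (v - n) = 0 := fun n =>
      truncPower_of_nonpos (by norm_num) (by linarith [(n.cast_nonneg : (0 : ℝ) ≤ n)])
    simp only [this, mul_zero, Finset.sum_const_zero]
    rw [truncPower_of_nonpos (by linarith) (by linarith),
      truncPower_of_nonpos (by linarith) (by linarith), mul_zero, sub_zero, sub_zero, abs_zero]
    positivity
  rcases lt_or_ge v 2 with hv2 | hv2
  · have b1 := abs_sum_grunwaldWeight_mul_truncPower_le h0 h1 (by norm_num : (0 : ℝ) < 4) hv hv2 hL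
    have b2 := truncPower_mono (by linarith : 0 ≤ 4 - α) (by linarith : v - α / 2 ≤ 2)
    have b3 := truncPower_nonneg (by linarith : 0 ≤ 4 - α) (v - α / 2)
    have c2 := mul_le_mul_of_nonneg_left
      (truncPower_mono (by linarith : 0 ≤ 2 - α) (by linarith : v - α / 2 ≤ 2))
      (by positivity : 0 ≤ α / 24)
    have c3 := mul_nonneg (by positivity : 0 ≤ α / 24)
      (truncPower_nonneg (by linarith : 0 ≤ 2 - α) (v - α / 2))
    have b4 := abs_sub (∑ n ∈ Finset.range L, grunwaldWeight α n * truncPower 4 (v - n))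
      (truncPower (4 - α) (v - α / 2))
    have b5 := abs_sub (∑ n ∈ Finset.range L, grunwaldWeight α n * truncPower 4 (v - n)
      - truncPower (4 - α) (v - α / 2)) (α / 24 * truncPower (2 - α) (v - α / 2))
    rw [abs_of_nonneg b3] at b4
    rw [abs_of_nonneg c3] at b5
    have hle : 0 ≤ 2 * truncPower 4 2 + truncPower (4 - α) 2 + α / 24 * truncPower (2 - α) 2
      + C / Real.Gamma (4 - α + 1) := by positivity
    have := le_mul_of_one_le_right hle hone
    linarith
  · rw [sum_grunwaldWeight_mul_truncPower_eq (by norm_num) hv hL]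
    obtain ⟨w, τ, hN, hw, hvτ, hτ, hw2, hwv, hwτ⟩ := exists_floor_decomposition h0 h1 hv2
    have hw0 : 0 < w := by linarith
    have ha := hasum ⌊v⌋₊ hN
    have hs := sum_grunwaldWeight_mul_fourth α ⌊v⌋₊ (τ + 1 / 2)
    rw [quarticGrunwaldPoly_eq hw0.ne' (by linarith : (⌊v⌋₊ : ℝ) = w - (1 - α) / 2) rfl] at hs
    have hsum : Real.Gamma (4 - α + 1) *
        ∑ n ∈ Finset.range (⌊v⌋₊ + 1), grunwaldWeight α n * truncPower 4 (v - n) =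
        Real.Gamma (1 - α) * grunwaldSum α ⌊v⌋₊ *
          (w ^ 4 * quarticGrunwaldSymbol α (1 / w) τ) := by
      have e : ∀ n ∈ Finset.range (⌊v⌋₊ + 1), grunwaldWeight α n * truncPower 4 (v - n) =
          grunwaldWeight α n * (⌊v⌋₊ - n + (τ + 1 / 2)) ^ 4 * (1 / 24) := by
        intro n hn
        rw [Finset.mem_range] at hn
        have hn' : (n : ℝ) ≤ ⌊v⌋₊ := by exact_mod_cast (by omega : n ≤ ⌊v⌋₊)
        have hfl := Nat.floor_le hv
        rw [truncPower_of_nonneg (by linarith), show (v : ℝ) - n = ⌊v⌋₊ - n + (τ + 1 / 2) by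
          linarith, show (4 : ℝ) + 1 = ((4 : ℕ) : ℝ) + 1 by norm_num,
          Real.Gamma_nat_eq_factorial]
        norm_num [Nat.factorial]
        ring_nf
      rw [Finset.sum_congr rfl e, ← Finset.sum_mul, hΓ4]
      linear_combination (Real.Gamma (1 - α) / 24) * hs
    rw [← hw] at ha
    set ε := Real.Gamma (1 - α) * grunwaldSum α ⌊v⌋₊ * w ^ α
      - (1 + gammaRatioCoeff α / w ^ 2) with hε
    have hx := hexp (1 / w) τ ε (by positivity) (by rw [div_le_div_iff₀] <;> linarith) hτ
      (ha.trans (le_of_eq (by field_simp)))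
    have hwα : w ^ (4 - α) * w ^ α = w ^ 4 := by
      rw [← Real.rpow_add hw0, sub_add_cancel]
      exact_mod_cast Real.rpow_natCast w 4
    have hwx : w ^ (4 - α) * (1 / w) ^ 3 = w ^ (1 - α) := by
      rw [show 4 - α = 1 - α + (3 : ℕ) by push_cast; ring, Real.rpow_add_natCast hw0.ne']
      field_simp
    have hwx2 : w ^ (4 - α) * (1 / w) ^ 2 = w ^ (2 - α) := by
      rw [show 4 - α = 2 - α + (2 : ℕ) by push_cast; ring, Real.rpow_add_natCast hw0.ne']
      field_simp
    -- The factor (4 - α)(3 - α) of the second-order term is Γ(5 - α)/Γ(3 - α), which turns it into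
    -- a multiple of the truncated power of exponent 2 - α.
    have hsecond : Real.Gamma (4 - α + 1) * (α / 24 * truncPower (2 - α) (v - α / 2)) =
        α / 24 * ((4 - α) * (3 - α)) * (w ^ (2 - α) * (1 + τ * (1 / w)) ^ (2 - α)) := by
      rw [truncPower_of_nonneg (by linarith), ← hwτ, rpow_add_eq hw2 hτ, hΓ3]
      field_simp
    have hmain : Real.Gamma (4 - α + 1) *
        (∑ n ∈ Finset.range (⌊v⌋₊ + 1), grunwaldWeight α n * truncPower 4 (v - n)
          - truncPower (4 - α) (v - α / 2) - α / 24 * truncPower (2 - α) (v - α / 2)) =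
        w ^ (4 - α) * ((1 + gammaRatioCoeff α * (1 / w) ^ 2 + ε) *
          quarticGrunwaldSymbol α (1 / w) τ - (1 + τ * (1 / w)) ^ (4 - α)
          - α / 24 * ((4 - α) * (3 - α)) * (1 / w) ^ 2 * (1 + τ * (1 / w)) ^ (2 - α)) := by
      rw [mul_sub, mul_sub, hsum, hsecond, truncPower_of_nonneg (by linarith),
        mul_div_cancel₀ _ hΓ4pos.ne', ← hwτ, rpow_add_eq hw2 hτ]
      have : 1 + gammaRatioCoeff α * (1 / w) ^ 2 + ε =
          Real.Gamma (1 - α) * grunwaldSum α ⌊v⌋₊ * w ^ α := by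
        rw [hε]
        ring
      rw [this]
      linear_combination (-Real.Gamma (1 - α) * grunwaldSum α ⌊v⌋₊ *
        quarticGrunwaldSymbol α (1 / w) τ) * hwα +
        α / 24 * ((4 - α) * (3 - α)) * (1 + τ * (1 / w)) ^ (2 - α) * hwx2
    have habs := congrArg abs hmain
    rw [abs_mul, abs_mul, abs_of_pos hΓ4pos, abs_of_pos (Real.rpow_pos_of_pos hw0 _)] at habs
    have hle : w ^ (4 - α) * (C * (1 / w) ^ 3) ≤ C * (1 + max v 0) ^ (1 - α) := by
      rw [mul_left_comm, hwx, max_eq_left hv]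
      gcongr
    have h5 := (habs.le.trans (mul_le_mul_of_nonneg_left hx (by positivity))).trans hle
    rw [← le_div_iff₀' hΓ4pos] at h5
    refine h5.trans ?_
    rw [mul_div_right_comm]
    gcongr
    have := mul_nonneg (by positivity : 0 ≤ α / 24) hTb
    linarith

/-! ### Integration by parts for fractional integrals -/

/-- The Riemann–Liouville integral of order `γ + 1` with lower limit `b`. -/
noncomputable def powerIntegral (γ b : ℝ) (g : ℝ → ℝ) (z : ℝ) : ℝ :=
  ∫ s in b..z, (z - s) ^ γ / Real.Gamma (γ + 1) * g s

/-- Integration by parts. For γ < 0 the kernel is singular at s = z, but it is integrable since γ >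
-1, and its primitive is continuous and vanishes there. -/
theorem powerIntegral_eq_add_powerIntegral_deriv {γ b z : ℝ} (hγ : -1 < γ) (hbz : b ≤ z)
    {g g' : ℝ → ℝ} (hg : ContinuousOn g (Icc b z)) (hg' : ContinuousOn g' (Icc b z))
    (hd : ∀ s ∈ Ioo b z, HasDerivAt g (g' s) s) :
    powerIntegral γ b g z = g b * ((z - b) ^ (γ + 1) / Real.Gamma (γ + 1 + 1)) +
      powerIntegral (γ + 1) b g' z := by
  have hΓ : Real.Gamma (γ + 1 + 1) = (γ + 1) * Real.Gamma (γ + 1) :=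
    Real.Gamma_add_one (by linarith)
  have hΓ0 := Real.Gamma_pos_of_pos (by linarith : 0 < γ + 1)
  have hγ1 : γ + 1 ≠ 0 := by linarith
  set v : ℝ → ℝ := fun s => -((z - s) ^ (γ + 1) / Real.Gamma (γ + 1 + 1)) with hv
  set v' : ℝ → ℝ := fun s => (z - s) ^ γ / Real.Gamma (γ + 1) with hv'
  have hvc : Continuous v := by
    simp only [hv]
    exact (((continuous_const.sub continuous_id).rpow_const
      (fun s => Or.inr (by linarith : 0 ≤ γ + 1))).div_const _).neg
  have hvd : ∀ s ∈ Ioo b z, HasDerivAt v (v' s) s := by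
    intro s hs
    have h1 : HasDerivAt (fun s => z - s) (-1) s := by
      simpa using (hasDerivAt_id s).const_sub z
    have h2 := ((h1.rpow_const (p := γ + 1) (Or.inl (by linarith [hs.2]))).div_const
      (Real.Gamma (γ + 1 + 1))).neg
    have e : v' s = -(-1 * (γ + 1) * (z - s) ^ (γ + 1 - 1) / Real.Gamma (γ + 1 + 1)) := by
      simp only [hv', hΓ, add_sub_cancel_right]
      field_simp
    rw [e]
    exact h2
  have hv'i : IntervalIntegrable v' volume b z := by
    have := ((intervalIntegral.intervalIntegrable_rpow' (a := z - b) (b := z - z)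
      hγ).comp_sub_left z).div_const (Real.Gamma (γ + 1))
    simpa only [sub_sub_cancel] using this
  have huIcc : uIcc b z = Icc b z := uIcc_of_le hbz
  have key := intervalIntegral.integral_mul_deriv_eq_deriv_mul_of_hasDerivAt (u := g) (v := v)
    (u' := g') (v' := v') (a := b) (b := z) (by rwa [huIcc]) hvc.continuousOn
    (by rwa [min_eq_left hbz, max_eq_right hbz]) (by rwa [min_eq_left hbz, max_eq_right hbz])
    (ContinuousOn.intervalIntegrable (by rwa [huIcc])) hv'i
  have hvz : v z = 0 := by simp [hv, Real.zero_rpow hγ1]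
  have e1 : powerIntegral γ b g z = ∫ s in b..z, g s * v' s := by
    unfold powerIntegral
    exact intervalIntegral.integral_congr fun s _ => mul_comm _ _
  have e2 : powerIntegral (γ + 1) b g' z = -∫ s in b..z, g' s * v s := by
    unfold powerIntegral
    rw [← intervalIntegral.integral_neg]
    refine intervalIntegral.integral_congr fun s _ => ?_
    simp only [hv]
    ring
  rw [e1, e2, key, hvz]
  simp only [hv]
  ring

theorem hasDerivAt_iteratedDerivWithin_Icc {y : ℝ → ℝ} {b X : ℝ} (hbX : b < X) {n k : ℕ}
    (hy : ContDiffOn ℝ n y (Icc b X)) (hk : k < n) {s : ℝ} (hs : s ∈ Ioo b X) :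
    HasDerivAt (iteratedDerivWithin k y (Icc b X)) (iteratedDerivWithin (k + 1) y (Icc b X) s)
      s := by
  have hu := uniqueDiffOn_Icc hbX
  have hs' : s ∈ Icc b X := Ioo_subset_Icc_self hs
  have := hy.differentiableOn_iteratedDerivWithin (by exact_mod_cast hk) hu s hs'
  rw [iteratedDerivWithin_succ]
  exact this.hasDerivWithinAt.hasDerivAt (Icc_mem_nhds hs.1 hs.2)

/-- Repeated integration by parts, in which only the last boundary term survives. The case γ = 0
yields Taylor's formula and γ = -α the Caputo derivative, with the same boundary value and density.
-/
theorem powerIntegral_iteratedDerivWithin {y : ℝ → ℝ} {b X γ z : ℝ} (hbX : b < X) (hγ : -1 < γ)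
    (hz : z ∈ Icc b X) {m : ℕ} (hy : ContDiffOn ℝ (m + 2 : ℕ) y (Icc b X))
    (h0 : ∀ k ≤ m, iteratedDerivWithin k y (Icc b X) b = 0) :
    powerIntegral γ b (iteratedDerivWithin 1 y (Icc b X)) z =
      iteratedDerivWithin (m + 1) y (Icc b X) b *
        ((z - b) ^ (γ + m + 1) / Real.Gamma (γ + m + 1 + 1)) +
      powerIntegral (γ + m + 1) b (iteratedDerivWithin (m + 2) y (Icc b X)) z := by
  have hu := uniqueDiffOn_Icc hbX
  have step : ∀ k : ℕ, k ≤ m → powerIntegral (γ + k) b (iteratedDerivWithin (k + 1) y (Icc b X)) z =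
      iteratedDerivWithin (k + 1) y (Icc b X) b *
        ((z - b) ^ (γ + k + 1) / Real.Gamma (γ + k + 1 + 1)) +
      powerIntegral (γ + k + 1) b (iteratedDerivWithin (k + 2) y (Icc b X)) z := by
    intro k hk
    have hsub : Icc b z ⊆ Icc b X := Icc_subset_Icc_right hz.2
    refine powerIntegral_eq_add_powerIntegral_deriv
      (by linarith [(k.cast_nonneg : (0 : ℝ) ≤ k)]) hz.1
      ((hy.continuousOn_iteratedDerivWithin (by exact_mod_cast (by omega)) hu).mono hsub)
      ((hy.continuousOn_iteratedDerivWithin (by exact_mod_cast (by omega)) hu).mono hsub)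
      fun s hs => hasDerivAt_iteratedDerivWithin_Icc hbX hy (by omega) ⟨hs.1, hs.2.trans_le hz.2⟩
  have iter : ∀ k : ℕ, k ≤ m → powerIntegral γ b (iteratedDerivWithin 1 y (Icc b X)) z =
      powerIntegral (γ + k) b (iteratedDerivWithin (k + 1) y (Icc b X)) z := by
    intro k
    induction k with
    | zero => intro _; simp
    | succ k ih =>
      intro hk
      rw [ih (by omega), step k (by omega), h0 (k + 1) hk]
      push_cast
      rw [zero_mul, zero_add, ← add_assoc]
  rw [iter m le_rfl, step m le_rfl]

/-! ### Superpositions of truncated powers -/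

/-- The functional `g ↦ c g(b) + ∫_b^X g f`. -/
noncomputable def boundaryIntegral (c b X : ℝ) (f g : ℝ → ℝ) : ℝ :=
  c * g b + ∫ s in b..X, g s * f s

theorem boundaryIntegral_sub {c b X : ℝ} {f g₁ g₂ : ℝ → ℝ} (hf : Continuous f)
    (h₁ : Continuous g₁) (h₂ : Continuous g₂) :
    boundaryIntegral c b X f (fun s => g₁ s - g₂ s) =
      boundaryIntegral c b X f g₁ - boundaryIntegral c b X f g₂ := by
  unfold boundaryIntegral
  simp only [sub_mul]
  have i₁ : IntervalIntegrable (fun s => g₁ s * f s) volume b X :=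
    (h₁.mul hf).intervalIntegrable _ _
  have i₂ : IntervalIntegrable (fun s => g₂ s * f s) volume b X :=
    (h₂.mul hf).intervalIntegrable _ _
  rw [intervalIntegral.integral_sub i₁ i₂]
  ring

theorem boundaryIntegral_const_mul (c b X : ℝ) (f g : ℝ → ℝ) (a : ℝ) :
    boundaryIntegral c b X f (fun s => a * g s) = a * boundaryIntegral c b X f g := by
  unfold boundaryIntegral
  simp only [mul_assoc]
  rw [intervalIntegral.integral_const_mul]
  ring

theorem boundaryIntegral_sum {c b X : ℝ} {f : ℝ → ℝ} (hf : Continuous f) (S : Finset ℕ)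
    {g : ℕ → ℝ → ℝ} (hg : ∀ n, Continuous (g n)) :
    boundaryIntegral c b X f (fun s => ∑ n ∈ S, g n s) =
      ∑ n ∈ S, boundaryIntegral c b X f (g n) := by
  unfold boundaryIntegral
  simp only [Finset.sum_mul]
  have hi : ∀ n ∈ S, IntervalIntegrable (fun s => g n s * f s) volume b X :=
    fun n _ => ((hg n).mul hf).intervalIntegrable _ _
  rw [intervalIntegral.integral_finsetSum hi,
    Finset.sum_add_distrib, Finset.mul_sum]

theorem exists_abs_boundaryIntegral_le {c b X : ℝ} (hbX : b ≤ X) {f : ℝ → ℝ}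
    (hf : Continuous f) :
    ∃ M > 0, ∀ (g : ℝ → ℝ) (K : ℝ), (∀ s ∈ Icc b X, |g s| ≤ K) →
      |boundaryIntegral c b X f g| ≤ M * K := by
  obtain ⟨B, hB⟩ := (isCompact_Icc (a := b) (b := X)).exists_bound_of_continuousOn hf.continuousOn
  refine ⟨|c| + |B| * (X - b) + 1, ?_, fun g K hK => ?_⟩
  · have : 0 ≤ |B| * (X - b) := mul_nonneg (abs_nonneg _) (by linarith)
    positivity
  have hK0 : 0 ≤ K := (abs_nonneg _).trans (hK b ⟨le_rfl, hbX⟩)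
  have h1 : ‖∫ s in b..X, g s * f s‖ ≤ K * |B| * |X - b| := by
    apply intervalIntegral.norm_integral_le_of_norm_le_const
    intro s hs
    rw [uIoc_of_le hbX] at hs
    rw [norm_mul]
    exact mul_le_mul (hK s ⟨hs.1.le, hs.2⟩) ((hB s ⟨hs.1.le, hs.2⟩).trans (le_abs_self B))
      (norm_nonneg _) hK0
  rw [Real.norm_eq_abs, abs_of_nonneg (by linarith : 0 ≤ X - b)] at h1
  have h2 : |c * g b| ≤ |c| * K := by
    rw [abs_mul]
    exact mul_le_mul_of_nonneg_left (hK b ⟨le_rfl, hbX⟩) (abs_nonneg _)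
  have h3 := abs_add_le (c * g b) (∫ s in b..X, g s * f s)
  unfold boundaryIntegral
  nlinarith

/-- The superposition of truncated powers of exponent `γ` with density `f` on `[b, X]` and an atom
of mass `c` at `b`. -/
noncomputable def truncPotential (c b X : ℝ) (f : ℝ → ℝ) (γ z : ℝ) : ℝ :=
  boundaryIntegral c b X f (fun s => truncPower γ (z - s))

theorem truncPotential_eq_powerIntegral {c b X γ z : ℝ} (hγ : 0 < γ) (hz : z ∈ Icc b X)
    {f g : ℝ → ℝ} (hf : Continuous f) (hfg : EqOn f g (Icc b X)) :
    truncPotential c b X f γ z =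
      c * ((z - b) ^ γ / Real.Gamma (γ + 1)) + powerIntegral γ b g z := by
  have hc : Continuous fun s => truncPower γ (z - s) * f s :=
    ((continuous_truncPower hγ.le).comp (by fun_prop)).mul hf
  unfold truncPotential boundaryIntegral powerIntegral
  beta_reduce
  rw [truncPower_of_nonneg (by linarith [hz.1]),
    ← intervalIntegral.integral_add_adjacent_intervals (hc.intervalIntegrable b z)
    (hc.intervalIntegrable z X)]
  have h1 : ∫ s in z..X, truncPower γ (z - s) * f s = 0 := by
    rw [← intervalIntegral.integral_zero (a := z) (b := X)]
    refine intervalIntegral.integral_congr fun s hs => ?_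
    rw [uIcc_of_le hz.2] at hs
    simp [truncPower_of_nonpos hγ.ne' (by linarith [hs.1] : z - s ≤ 0)]
  rw [h1, add_zero]
  congr 1
  refine intervalIntegral.integral_congr fun s hs => ?_
  rw [uIcc_of_le hz.1] at hs
  rw [truncPower_of_nonneg (by linarith [hs.2]), hfg ⟨hs.1, hs.2.trans hz.2⟩]

theorem truncPotential_of_le {c b X γ z : ℝ} (hbX : b ≤ X) (hγ : γ ≠ 0) (hz : z ≤ b) (f : ℝ → ℝ) :
    truncPotential c b X f γ z = 0 := by
  have h1 : ∫ s in b..X, truncPower γ (z - s) * f s = 0 := by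
    rw [← intervalIntegral.integral_zero (a := b) (b := X)]
    refine intervalIntegral.integral_congr fun s hs => ?_
    rw [uIcc_of_le hbX] at hs
    simp [truncPower_of_nonpos hγ (by linarith [hs.1] : z - s ≤ 0)]
  unfold truncPotential boundaryIntegral
  beta_reduce
  rw [h1, truncPower_of_nonpos hγ (by linarith)]
  simp

theorem continuous_truncPotential {c b X γ : ℝ} (hγ : 0 ≤ γ) {f : ℝ → ℝ} (hf : Continuous f) :
    Continuous (truncPotential c b X f γ) := by
  have hc := continuous_truncPower hγ
  unfold truncPotential boundaryIntegral
  refine (continuous_const.mul (hc.comp (by fun_prop))).add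
    (intervalIntegral.continuous_parametric_intervalIntegral_of_continuous' ?_ _ _)
  exact (hc.comp (by fun_prop)).mul (hf.comp continuous_snd)

theorem hasDerivAt_truncPotential {c b X γ : ℝ} (hγ : 1 < γ) {f : ℝ → ℝ}
    (hf : Continuous f) (z : ℝ) :
    HasDerivAt (truncPotential c b X f γ) (truncPotential c b X f (γ - 1) z) z := by
  have hc := continuous_truncPower (by linarith : 0 ≤ γ)
  have hc' := continuous_truncPower (by linarith : 0 ≤ γ - 1)
  unfold truncPotential boundaryIntegral
  have hd : ∀ s w : ℝ, HasDerivAt (fun z => truncPower γ (z - s)) (truncPower (γ - 1) (w - s)) w :=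
    fun s w => (hasDerivAt_truncPower hγ (w - s)).comp_sub_const w s
  refine ((hd b z).const_mul c).add ?_
  have hcm : ∀ w, Continuous fun s => truncPower γ (w - s) * f s := fun w =>
    (hc.comp (by fun_prop)).mul hf
  have hcm' : ∀ w, Continuous fun s => truncPower (γ - 1) (w - s) * f s := fun w =>
    (hc'.comp (by fun_prop)).mul hf
  refine (intervalIntegral.hasDerivAt_integral_of_dominated_loc_of_deriv_le
    (F := fun z s => truncPower γ (z - s) * f s)
    (F' := fun z s => truncPower (γ - 1) (z - s) * f s)
    -- Truncated powers are monotone, so the value at z + 1 dominates the derivative for all nearby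
    -- w < z + 1.
    (bound := fun s => truncPower (γ - 1) (z + 1 - s) * |f s|)
    (Iio_mem_nhds (by linarith : z < z + 1)) (Eventually.of_forall fun w =>
      (hcm w).aestronglyMeasurable) ((hcm z).intervalIntegrable _ _)
    (hcm' z).aestronglyMeasurable ?_ ?_ ?_).2
  · refine Eventually.of_forall fun s _ w hw => ?_
    rw [norm_mul, Real.norm_eq_abs, Real.norm_eq_abs,
      abs_of_nonneg (truncPower_nonneg (by linarith) _)]
    refine mul_le_mul_of_nonneg_right (truncPower_mono (by linarith) ?_) (abs_nonneg _)
    linarith [mem_Iio.1 hw]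
  · exact ((hc'.comp (by fun_prop)).mul hf.abs).intervalIntegrable _ _
  · exact Eventually.of_forall fun s _ w _ => (hd s w).mul_const (f s)

theorem eq_powerIntegral_zero {y : ℝ → ℝ} {b X z : ℝ} (hbX : b < X) (hz : z ∈ Icc b X) {n : ℕ}
    (hn : 1 ≤ n) (hy : ContDiffOn ℝ n y (Icc b X)) (hyb : y b = 0) :
    y z = powerIntegral 0 b (iteratedDerivWithin 1 y (Icc b X)) z := by
  have hsub : Icc b z ⊆ Icc b X := Icc_subset_Icc_right hz.2
  have hc := hy.continuousOn_iteratedDerivWithin (m := 1) (by exact_mod_cast hn)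
    (uniqueDiffOn_Icc hbX)
  have h := intervalIntegral.integral_eq_sub_of_hasDerivAt_of_le hz.1 (hy.continuousOn.mono hsub)
    (fun s hs => by
      have := hasDerivAt_iteratedDerivWithin_Icc (k := 0) hbX hy (by omega)
        ⟨hs.1, hs.2.trans_le hz.2⟩
      rwa [iteratedDerivWithin_zero] at this)
    (ContinuousOn.intervalIntegrable (by rw [uIcc_of_le hz.1]; exact hc.mono hsub))
  rw [hyb, sub_zero] at h
  simp [powerIntegral, ← h]

theorem caputoDeriv_eq_powerIntegral {α : ℝ} {y : ℝ → ℝ} {b X z : ℝ} (hbX : b < X)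
    (hz : z ∈ Icc b X) {n : ℕ} (hn : 1 ≤ n) (hy : ContDiffOn ℝ n y (Icc b X)) :
    caputoDeriv α b y z = powerIntegral (-α) b (iteratedDerivWithin 1 y (Icc b X)) z := by
  unfold caputoDeriv powerIntegral
  rw [← intervalIntegral.integral_const_mul]
  refine intervalIntegral.integral_congr_Ioo_of_le hz.1 fun s hs => ?_
  have := hasDerivAt_iteratedDerivWithin_Icc (k := 0) hbX hy (by omega)
    ⟨hs.1, hs.2.trans_le hz.2⟩
  rw [iteratedDerivWithin_zero] at this
  rw [this.deriv, Real.rpow_neg (by linarith [hs.2]), neg_add_eq_sub]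
  ring

theorem exists_eq_truncPotential {α : ℝ} (h1 : α < 1) {y : ℝ → ℝ} {b X : ℝ} (hbX : b < X)
    {m : ℕ} (hy : ContDiffOn ℝ (m + 2 : ℕ) y (Icc b X))
    (h0 : ∀ k ≤ m, iteratedDerivWithin k y (Icc b X) b = 0) :
    ∃ (c : ℝ) (f : ℝ → ℝ), Continuous f ∧
      (∀ z ∈ Icc b X, y z = truncPotential c b X f (m + 1) z) ∧
      (∀ z ∈ Icc b X, caputoDeriv α b y z = truncPotential c b X f (m + 1 - α) z) := by
  have hc := hy.continuousOn_iteratedDerivWithin (m := m + 2) le_rfl (uniqueDiffOn_Icc hbX)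
  have hyb : y b = 0 := by simpa using h0 0 (by omega)
  have hm : (0 : ℝ) ≤ m := m.cast_nonneg
  -- The top derivative is extended by its end values, giving a density continuous on all of ℝ.
  have hf : Continuous (IccExtend hbX.le
      ((Icc b X).domRestrict (iteratedDerivWithin (m + 2) y (Icc b X)))) :=
    (continuousOn_iff_continuous_domRestrict.1 hc).Icc_extend'
  have hfg : EqOn (IccExtend hbX.le
      ((Icc b X).domRestrict (iteratedDerivWithin (m + 2) y (Icc b X))))
      (iteratedDerivWithin (m + 2) y (Icc b X)) (Icc b X) := fun s hs => by
    rw [IccExtend_of_mem _ _ hs]; rfl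
  refine ⟨iteratedDerivWithin (m + 1) y (Icc b X) b, _, hf, fun z hz => ?_, fun z hz => ?_⟩
  · rw [eq_powerIntegral_zero hbX hz (by omega) hy hyb,
      powerIntegral_iteratedDerivWithin hbX (by norm_num) hz hy h0,
      truncPotential_eq_powerIntegral (by linarith) hz hf hfg, zero_add]
  · rw [caputoDeriv_eq_powerIntegral hbX hz (by omega) hy,
      powerIntegral_iteratedDerivWithin hbX (by linarith) hz hy h0,
      truncPotential_eq_powerIntegral (by linarith) hz hf hfg,
      show -α + m + 1 = m + 1 - α by ring]

/-! ### From the kernel to functions -/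

/-- By homogeneity the error for the kernel centred at s is h^(μ-α) times the unit-step error at v =
(u - s)/h. The growth (1 + v₊)^(1-α) is absorbed by h^(1-α), leaving h^(μ-1) uniformly in s; the
bounded functional then carries this over to the superposition. -/
theorem exists_abs_sum_grunwaldWeight_mul_truncPotential_sub_le {α a μ : ℝ}
    (h1 : α < 1) (hμ : 3 ≤ μ)
    (hker : ∃ C > 0, ∀ (v : ℝ) (L : ℕ), v < L →
      |∑ n ∈ Finset.range L, grunwaldWeight α n * truncPower μ (v - n)
        - truncPower (μ - α) (v - α / 2) - a * truncPower (μ - 2 - α) (v - α / 2)| ≤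
        C * (1 + max v 0) ^ (1 - α))
    {c b X : ℝ} (hbX : b ≤ X) {f : ℝ → ℝ} (hf : Continuous f) (H : ℝ) :
    ∃ C : ℝ, ∀ (h u : ℝ) (L : ℕ), 0 < h → h ≤ H → u ≤ X → (u - b) / h < L →
      |h ^ (-α) * ∑ n ∈ Finset.range L, grunwaldWeight α n * truncPotential c b X f μ (u - n * h)
        - truncPotential c b X f (μ - α) (u - α / 2 * h)
        - a * h ^ 2 * truncPotential c b X f (μ - 2 - α) (u - α / 2 * h)| ≤
        C * h ^ (μ - 1) := by
  obtain ⟨C, hC, hker⟩ := hker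
  obtain ⟨M, hM, hbd⟩ := exists_abs_boundaryIntegral_le (c := c) hbX hf
  refine ⟨M * (C * (H + (X - b)) ^ (1 - α)), fun h u L hh hhH hu hL => ?_⟩
  have hcont : ∀ γ : ℝ, 0 ≤ γ → ∀ w, Continuous fun s => truncPower γ (w - s) := fun γ hγ w =>
    (continuous_truncPower hγ).comp (by fun_prop)
  set E : ℝ → ℝ := fun s => h ^ (-α) * ∑ n ∈ Finset.range L,
      grunwaldWeight α n * truncPower μ (u - n * h - s)
    - truncPower (μ - α) (u - α / 2 * h - s)
    - a * h ^ 2 * truncPower (μ - 2 - α) (u - α / 2 * h - s) with hE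
  have hEbd : ∀ s ∈ Icc b X, |E s| ≤ C * (H + (X - b)) ^ (1 - α) * h ^ (μ - 1) := by
    intro s hs
    have hv : (u - s) / h < L :=
      lt_of_le_of_lt (div_le_div_of_nonneg_right (by linarith [hs.1]) hh.le) hL
    have hk := hker _ _ hv
    have e1 : h ^ (-α) * h ^ μ = h ^ (μ - α) := by
      rw [← Real.rpow_add hh]; ring_nf
    have e2 : h ^ 2 * h ^ (μ - 2 - α) = h ^ (μ - α) := by
      rw [← Real.rpow_natCast h 2, ← Real.rpow_add hh]
      push_cast
      ring_nf
    have hEs : E s = h ^ (μ - α) *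
        (∑ n ∈ Finset.range L, grunwaldWeight α n * truncPower μ ((u - s) / h - n)
        - truncPower (μ - α) ((u - s) / h - α / 2)
        - a * truncPower (μ - 2 - α) ((u - s) / h - α / 2)) := by
      have t1 : ∀ n : ℕ, grunwaldWeight α n * truncPower μ (u - n * h - s) =
          h ^ μ * (grunwaldWeight α n * truncPower μ ((u - s) / h - n)) := by
        intro n
        rw [show u - n * h - s = h * ((u - s) / h - n) by field_simp; ring, truncPower_mul hh]
        ring
      have t2 : u - α / 2 * h - s = h * ((u - s) / h - α / 2) := by field_simp; ring
      simp only [hE, t1]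
      rw [← Finset.mul_sum, t2, truncPower_mul hh, truncPower_mul hh, ← mul_assoc, e1, mul_sub,
        mul_sub]
      linear_combination
        (-a * truncPower (μ - 2 - α) ((u - s) / h - α / 2)) * e2
    rw [hEs, abs_mul, abs_of_pos (Real.rpow_pos_of_pos hh _)]
    refine (mul_le_mul_of_nonneg_left hk (Real.rpow_nonneg hh.le _)).trans ?_
    have hmax : 0 ≤ max ((u - s) / h) 0 := le_max_right _ _
    have hXb : 0 ≤ X - b := by linarith
    have e3 : h ^ (μ - α) = h ^ (1 - α) * h ^ (μ - 1) := by
      rw [← Real.rpow_add hh]; ring_nf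
    have e4 : h ^ (1 - α) * (1 + max ((u - s) / h) 0) ^ (1 - α) ≤ (H + (X - b)) ^ (1 - α) := by
      rw [← Real.mul_rpow hh.le (by linarith)]
      apply Real.rpow_le_rpow (mul_nonneg hh.le (by linarith)) _ (by linarith)
      rw [mul_add, mul_one, mul_max_of_nonneg _ _ hh.le, mul_zero, mul_div_cancel₀ _ hh.ne']
      exact add_le_add hhH (max_le (by linarith [hs.1]) hXb)
    rw [e3]
    calc h ^ (1 - α) * h ^ (μ - 1) * (C * (1 + max ((u - s) / h) 0) ^ (1 - α))
        = C * (h ^ (1 - α) * (1 + max ((u - s) / h) 0) ^ (1 - α)) * h ^ (μ - 1) := by ring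
      _ ≤ _ := by
        have := Real.rpow_nonneg hh.le (μ - 1)
        gcongr
  have key : boundaryIntegral c b X f E =
      h ^ (-α) * ∑ n ∈ Finset.range L, grunwaldWeight α n * truncPotential c b X f μ (u - n * h)
        - truncPotential c b X f (μ - α) (u - α / 2 * h)
        - a * h ^ 2 * truncPotential c b X f (μ - 2 - α) (u - α / 2 * h) := by
    have c1 : ∀ n : ℕ, Continuous fun s => grunwaldWeight α n * truncPower μ (u - n * h - s) :=
      fun n => (hcont μ (by linarith) _).const_mul _
    have c2 : Continuous fun s => h ^ (-α) * ∑ n ∈ Finset.range L,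
      grunwaldWeight α n * truncPower μ (u - n * h - s) :=
      (continuous_finsetSum _ fun n _ => c1 n).const_mul _
    have c3 := hcont (μ - α) (by linarith) (u - α / 2 * h)
    have c4 := (hcont (μ - 2 - α) (by linarith) (u - α / 2 * h)).const_mul (a * h ^ 2)
    have c5 : Continuous fun s => h ^ (-α) * ∑ n ∈ Finset.range L,
        grunwaldWeight α n * truncPower μ (u - n * h - s)
        - truncPower (μ - α) (u - α / 2 * h - s) := c2.sub c3
    simp only [hE]
    rw [boundaryIntegral_sub hf c5 c4, boundaryIntegral_sub hf c2 c3,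
      boundaryIntegral_const_mul, boundaryIntegral_const_mul, boundaryIntegral_sum hf _ c1]
    simp only [boundaryIntegral_const_mul]
    rfl
  rw [← key]
  refine (hbd E _ hEbd).trans (le_of_eq (by ring))

theorem exists_abs_truncPotential_le {c b X μ : ℝ} (hμ : 0 ≤ μ) (hbX : b ≤ X) {f : ℝ → ℝ}
    (hf : Continuous f) :
    ∃ M > 0, ∀ z : ℝ, |truncPotential c b X f μ z| ≤ M * truncPower μ (z - b) := by
  obtain ⟨M, hM, hbd⟩ := exists_abs_boundaryIntegral_le (c := c) hbX hf
  refine ⟨M, hM, fun z => hbd _ _ fun s hs => ?_⟩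
  rw [abs_of_nonneg (truncPower_nonneg hμ _)]
  exact truncPower_mono hμ (by linarith [hs.1])

theorem exists_abs_truncPotential_sub_le {c b X μ : ℝ} (hμ : 1 < μ) (hbX : b ≤ X) {f : ℝ → ℝ}
    (hf : Continuous f) :
    ∃ K ≥ 0, ∀ x ∈ Icc b X, ∀ z ∈ Icc b X,
      |truncPotential c b X f μ x - truncPotential c b X f μ z| ≤ K * |x - z| := by
  obtain ⟨M, hM, hbd⟩ := exists_abs_truncPotential_le (c := c) (by linarith : 0 ≤ μ - 1) hbX hf
  refine ⟨M * truncPower (μ - 1) (X - b),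
    mul_nonneg hM.le (truncPower_nonneg (by linarith) _), fun x hx z hz => ?_⟩
  have := (convex_Icc b X).norm_image_sub_le_of_norm_hasDerivWithin_le
    (f := truncPotential c b X f μ) (C := M * truncPower (μ - 1) (X - b))
    (fun s _ => (hasDerivAt_truncPotential hμ hf s).hasDerivWithinAt) (fun s hs => by
      rw [Real.norm_eq_abs]
      refine (hbd s).trans (mul_le_mul_of_nonneg_left ?_ hM.le)
      exact truncPower_mono (by linarith) (by linarith [hs.2])) hz hx
  simpa using this

/-- A node can fall left of b only if p < 0, and there both the extended y and the potential vanish.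
-/
theorem shiftedGrunwald_eq_sum_truncPotential {α p b X h x μ c : ℝ} {y f : ℝ → ℝ}
    (hμ : μ ≠ 0) (hneg : p < 0 → ∀ t < b, y t = 0)
    (hy : ∀ z ∈ Icc b X, y z = truncPotential c b X f μ z)
    (hh : 0 < h) (hbx : b ≤ x) (hxX : x ≤ X) (hpX : x + p * h ≤ X) :
    shiftedGrunwald α p b h y x = ∑ n ∈ Finset.range (⌊(x - b) / h⌋₊ + 1),
      grunwaldWeight α n * truncPotential c b X f μ (x + p * h - n * h) := by
  unfold shiftedGrunwald
  refine Finset.sum_congr rfl fun n hn => ?_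
  rw [show x - ((n : ℝ) - p) * h = x + p * h - n * h by ring]
  congr 1
  rcases lt_or_ge (x + p * h - n * h) b with ht | ht
  · have hnx : (n : ℝ) * h ≤ x - b := by
      rw [← le_div_iff₀ hh]
      have h2 : (n : ℝ) ≤ ⌊(x - b) / h⌋₊ := by
        exact_mod_cast Nat.lt_succ_iff.1 (Finset.mem_range.1 hn)
      exact h2.trans (Nat.floor_le (div_nonneg (by linarith) hh.le))
    have hp : p < 0 := by
      by_contra hp
      have := mul_nonneg (not_lt.1 hp) hh.le
      linarith
    rw [hneg hp _ ht, truncPotential_of_le (hbx.trans hxX) hμ ht.le]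
  · refine hy _ ⟨ht, ?_⟩
    have : 0 ≤ (n : ℝ) * h := by positivity
    linarith

/-- The ⌈p⌉₊ extra nodes lie at most ph to the right of b, where the potential is O(h^μ). -/
theorem exists_abs_sum_range_sub_sum_range_le {α p c b X μ : ℝ} (h0 : 0 < α) (h1 : α < 1)
    (hμ : 0 ≤ μ) (hbX : b ≤ X) {f : ℝ → ℝ} (hf : Continuous f) :
    ∃ C : ℝ, ∀ h x : ℝ, 0 < h → b ≤ x →
      |∑ n ∈ Finset.range (⌊(x - b) / h⌋₊ + 1 + ⌈p⌉₊),
          grunwaldWeight α n * truncPotential c b X f μ (x + p * h - n * h)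
        - ∑ n ∈ Finset.range (⌊(x - b) / h⌋₊ + 1),
          grunwaldWeight α n * truncPotential c b X f μ (x + p * h - n * h)| ≤ C * h ^ μ := by
  obtain ⟨M, hM, hbd⟩ := exists_abs_truncPotential_le (c := c) hμ hbX hf
  refine ⟨⌈p⌉₊ * (M * truncPower μ p), fun h x hh hbx => ?_⟩
  rw [Finset.sum_range_add, add_sub_cancel_left]
  refine (Finset.abs_sum_le_sum_abs _ _).trans ?_
  have hterm : ∀ k ∈ Finset.range ⌈p⌉₊,
      |grunwaldWeight α (⌊(x - b) / h⌋₊ + 1 + k) * truncPotential c b X f μ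
        (x + p * h - ((⌊(x - b) / h⌋₊ + 1 + k : ℕ) : ℝ) * h)| ≤ M * truncPower μ p * h ^ μ := by
    intro k _
    rw [abs_mul]
    have hk : x - b ≤ ((⌊(x - b) / h⌋₊ + 1 + k : ℕ) : ℝ) * h := by
      rw [← div_le_iff₀ hh]
      have h3 := (Nat.lt_floor_add_one ((x - b) / h)).le
      push_cast
      linarith [(k.cast_nonneg : (0 : ℝ) ≤ k)]
    have h4 := truncPower_mono hμ (by linarith :
      x + p * h - ((⌊(x - b) / h⌋₊ + 1 + k : ℕ) : ℝ) * h - b ≤ h * p)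
    rw [truncPower_mul hh] at h4
    calc _ ≤ 1 * (M * (h ^ μ * truncPower μ p)) :=
          mul_le_mul (abs_grunwaldWeight_le_one h0 h1 _)
            ((hbd _).trans (mul_le_mul_of_nonneg_left h4 hM.le)) (abs_nonneg _) zero_le_one
      _ = _ := by ring
  refine (Finset.sum_le_sum hterm).trans (le_of_eq ?_)
  simp
  ring

/-- The expansion of the shifted Grünwald difference of a function that is a superposition of
truncated powers. -/
theorem exists_abs_shiftedGrunwald_sub_truncPotential_le {α p a μ : ℝ} (h0 : 0 < α)
    (h1 : α < 1) (hμ : 3 ≤ μ)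
    (hker : ∃ C > 0, ∀ (v : ℝ) (L : ℕ), v < L →
      |∑ n ∈ Finset.range L, grunwaldWeight α n * truncPower μ (v - n)
        - truncPower (μ - α) (v - α / 2) - a * truncPower (μ - 2 - α) (v - α / 2)| ≤
        C * (1 + max v 0) ^ (1 - α))
    {c b X : ℝ} {y f : ℝ → ℝ} (hbX : b < X) (hf : Continuous f)
    (hneg : p < 0 → ∀ t < b, y t = 0)
    (hy : ∀ z ∈ Icc b X, y z = truncPotential c b X f μ z) :
    ∃ C : ℝ, ∀ h x : ℝ, 0 < h → b ≤ x → x ≤ X → x + p * h ≤ X → b ≤ x + (p - α / 2) * h →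
      |h ^ (-α) * shiftedGrunwald α p b h y x
        - truncPotential c b X f (μ - α) (x + (p - α / 2) * h)
        - a * h ^ 2 * truncPotential c b X f (μ - 2 - α) (x + (p - α / 2) * h)| ≤
        C * h ^ (μ - 1) := by
  -- Admissibility bounds h: subtracting b ≤ x + (p - α/2)h from x + ph ≤ X gives αh/2 ≤ X - b.
  set H := 2 * (X - b) / α with hH
  obtain ⟨C₁, h₁⟩ := exists_abs_sum_grunwaldWeight_mul_truncPotential_sub_le h1 hμ hker
    (c := c) hbX.le hf H
  obtain ⟨C₂, h₂⟩ := exists_abs_sum_range_sub_sum_range_le (p := p) (c := c) h0 h1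
    (by linarith : 0 ≤ μ) hbX.le hf
  refine ⟨C₁ + |C₂| * H ^ (1 - α), fun h x hh hbx hxX hpX hbz => ?_⟩
  have hhH : h ≤ H := by
    rw [hH, le_div_iff₀ h0]
    linarith
  -- With ⌈p⌉₊ additional terms the sum reaches past every node at which a kernel can be nonzero.
  have hL : (x + p * h - b) / h < (⌊(x - b) / h⌋₊ + 1 + ⌈p⌉₊ : ℕ) := by
    have e : (x + p * h - b) / h = (x - b) / h + p := by field_simp; ring
    have a1 := Nat.lt_floor_add_one ((x - b) / h)
    have a2 := Nat.le_ceil p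
    rw [e]
    push_cast
    linarith
  have b₁ := h₁ h (x + p * h) _ hh hhH hpX hL
  have b₂ := h₂ h x hh hbx
  rw [← shiftedGrunwald_eq_sum_truncPotential (by linarith) hneg hy hh hbx hxX hpX] at b₂
  rw [show x + p * h - α / 2 * h = x + (p - α / 2) * h by ring] at b₁
  generalize ∑ n ∈ Finset.range (⌊(x - b) / h⌋₊ + 1 + ⌈p⌉₊),
          grunwaldWeight α n * truncPotential c b X f μ (x + p * h - n * h) = S at *
  generalize shiftedGrunwald α p b h y x = T at *
  generalize truncPotential c b X f (μ - α) (x + (p - α / 2) * h) = F at *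
  generalize a * h ^ 2 * truncPotential c b X f (μ - 2 - α) (x + (p - α / 2) * h) = G at *
  have e : h ^ (-α) * T - F - G = (h ^ (-α) * S - F - G) - h ^ (-α) * (S - T) := by ring
  have hpos := Real.rpow_pos_of_pos hh (-α)
  have e2 : h ^ (-α) * h ^ μ = h ^ (1 - α) * h ^ (μ - 1) := by
    rw [← Real.rpow_add hh, ← Real.rpow_add hh]; ring_nf
  have b₃ : |h ^ (-α) * (S - T)| ≤ |C₂| * H ^ (1 - α) * h ^ (μ - 1) := by
    rw [abs_mul, abs_of_pos hpos]
    have hle : h ^ (1 - α) ≤ H ^ (1 - α) := Real.rpow_le_rpow hh.le hhH (by linarith)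
    have hn := Real.rpow_nonneg hh.le (μ - 1)
    have hn2 := Real.rpow_nonneg hh.le μ
    calc h ^ (-α) * |S - T| ≤ h ^ (-α) * (|C₂| * h ^ μ) := by
          gcongr
          exact b₂.trans (mul_le_mul_of_nonneg_right (le_abs_self _) hn2)
      _ = |C₂| * (h ^ (-α) * h ^ μ) := by ring
      _ = |C₂| * h ^ (1 - α) * h ^ (μ - 1) := by rw [e2]; ring
      _ ≤ _ := by gcongr
  rw [e]
  have := abs_sub (h ^ (-α) * S - F - G) (h ^ (-α) * (S - T))
  linarith

/-- Each differentiation lowers the exponent by one. The potential is C² on the whole line, so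
one-sided derivatives at the end points are ordinary ones. -/
theorem contDiffOn_two_and_iteratedDerivWithin_truncPotential {c b X μ : ℝ} (hμ : 2 < μ)
    (hbX : b < X) {f g : ℝ → ℝ} (hf : Continuous f)
    (hg : ∀ z ∈ Icc b X, g z = truncPotential c b X f μ z) :
    ContDiffOn ℝ 2 g (Icc b X) ∧
      ∀ z ∈ Icc b X, iteratedDerivWithin 2 g (Icc b X) z = truncPotential c b X f (μ - 2) z := by
  have d1 : deriv (truncPotential c b X f μ) = truncPotential c b X f (μ - 1) :=
    funext fun z => (hasDerivAt_truncPotential (by linarith) hf z).deriv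
  have d2 : deriv (truncPotential c b X f (μ - 1)) = truncPotential c b X f (μ - 2) :=
    funext fun z => by
      rw [(hasDerivAt_truncPotential (by linarith) hf z).deriv]
      ring_nf
  have hC : ContDiff ℝ 2 (truncPotential c b X f μ) := by
    rw [show (2 : WithTop ℕ∞) = 1 + 1 by norm_num, contDiff_succ_iff_deriv]
    refine ⟨fun z => (hasDerivAt_truncPotential (by linarith) hf z).differentiableAt, by simp, ?_⟩
    rw [d1, contDiff_one_iff_deriv]
    refine ⟨fun z => (hasDerivAt_truncPotential (by linarith) hf z).differentiableAt, ?_⟩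
    rw [d2]
    exact continuous_truncPotential (by linarith) hf
  refine ⟨hC.contDiffOn.congr hg, fun z hz => ?_⟩
  rw [iteratedDerivWithin_congr hg hz,
    iteratedDerivWithin_eq_iteratedDeriv (uniqueDiffOn_Icc hbX) hC.contDiffAt hz,
    iteratedDeriv_succ, iteratedDeriv_one, d1, d2]

theorem theorem1 (α p b X : ℝ) (hα0 : 0 < α) (hα1 : α < 1) (hbX : b < X) (y : ℝ → ℝ)
    (hneg : p < 0 → ∀ t < b, y t = 0) :
    (ContDiffOn ℝ 4 y (Set.Icc b X) →
      (∀ k ≤ 2, iteratedDerivWithin k y (Set.Icc b X) b = 0) →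
      ∃ C : ℝ, ∀ h x : ℝ, 0 < h → b ≤ x → x ≤ X → x + p * h ≤ X → b ≤ x + (p - α / 2) * h →
        |h ^ (-α) * shiftedGrunwald α p b h y x
            - caputoDeriv α b y (x + (p - α / 2) * h)| ≤ C * h ^ 2) ∧
    (ContDiffOn ℝ 5 y (Set.Icc b X) →
      (∀ k ≤ 3, iteratedDerivWithin k y (Set.Icc b X) b = 0) →
      ContDiffOn ℝ 2 (caputoDeriv α b y) (Set.Icc b X) ∧
      ∃ C : ℝ, ∀ h x : ℝ, 0 < h → b ≤ x → x ≤ X → x + p * h ≤ X → b ≤ x + (p - α / 2) * h →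
        |h ^ (-α) * shiftedGrunwald α p b h y x
            - (caputoDeriv α b y (x + (p - α / 2) * h)
              + α / 24 * h ^ 2 * millerRossDerivTwo α b X y x)| ≤ C * h ^ 3) := by
  have hmem : ∀ h x : ℝ, 0 < h → x + p * h ≤ X → b ≤ x + (p - α / 2) * h →
      x + (p - α / 2) * h ∈ Icc b X := fun h x hh hpX hbz =>
    ⟨hbz, by linarith [mul_pos hα0 hh]⟩
  constructor
  · intro hy h0
    obtain ⟨c, f, hf, hyF, hcF⟩ := exists_eq_truncPotential (m := 2) hα1 hbX hy h0
    rw [show (((2 : ℕ) : ℝ) + 1) = 3 by norm_num] at hyF hcF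
    obtain ⟨C, hC⟩ := exists_abs_shiftedGrunwald_sub_truncPotential_le (a := 0) hα0 hα1 le_rfl
      (by simpa using exists_abs_sum_grunwaldWeight_mul_truncPower_three_sub_le hα0 hα1)
      hbX hf hneg hyF
    refine ⟨C, fun h x hh hbx hxX hpX hbz => ?_⟩
    have := hC h x hh hbx hxX hpX hbz
    rw [zero_mul, zero_mul, sub_zero, show (3 : ℝ) - 1 = (2 : ℕ) by norm_num,
      Real.rpow_natCast] at this
    rwa [hcF _ (hmem h x hh hpX hbz)]
  · intro hy h0
    obtain ⟨c, f, hf, hyF, hcF⟩ := exists_eq_truncPotential (m := 3) hα1 hbX hy h0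
    rw [show (((3 : ℕ) : ℝ) + 1) = 4 by norm_num] at hyF hcF
    obtain ⟨hreg, hder⟩ := contDiffOn_two_and_iteratedDerivWithin_truncPotential
      (by linarith : 2 < 4 - α) hbX hf hcF
    refine ⟨hreg, ?_⟩
    obtain ⟨C, hC⟩ := exists_abs_shiftedGrunwald_sub_truncPotential_le (a := α / 24) hα0 hα1
      (by norm_num : (3 : ℝ) ≤ 4)
      (by
        rw [show (4 : ℝ) - 2 = 2 by norm_num]
        exact exists_abs_sum_grunwaldWeight_mul_truncPower_four_sub_le hα0 hα1)
      hbX hf hneg hyF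
    -- The potential of exponent 2 - α > 1 is Lipschitz on [b, X]; moving its argument by (p - α/2)h
    -- costs O(h), hence O(h³) after the factor h².
    obtain ⟨K, hK, hlip⟩ := exists_abs_truncPotential_sub_le (c := c)
      (by linarith : 1 < 4 - α - 2) hbX.le hf
    refine ⟨C + α / 24 * (K * |p - α / 2|), fun h x hh hbx hxX hpX hbz => ?_⟩
    have b₁ := hC h x hh hbx hxX hpX hbz
    have hz := hmem h x hh hpX hbz
    have b₂ := hlip _ hz x ⟨hbx, hxX⟩
    rw [add_sub_cancel_left, abs_mul, abs_of_pos hh] at b₂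
    rw [show (4 : ℝ) - 1 = (3 : ℕ) by norm_num, Real.rpow_natCast,
      show (4 : ℝ) - 2 - α = 4 - α - 2 by ring] at b₁
    rw [millerRossDerivTwo, hder x ⟨hbx, hxX⟩, hcF _ hz]
    generalize h ^ (-α) * shiftedGrunwald α p b h y x = S at *
    generalize truncPotential c b X f (4 - α) (x + (p - α / 2) * h) = F at *
    generalize truncPotential c b X f (4 - α - 2) (x + (p - α / 2) * h) = G at *
    generalize truncPotential c b X f (4 - α - 2) x = G' at *
    have e : S - (F + α / 24 * h ^ 2 * G') =
        (S - F - α / 24 * h ^ 2 * G) + α / 24 * h ^ 2 * (G - G') := by ring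
    have hpos : 0 ≤ α / 24 * h ^ 2 := by positivity
    have b₃ : |α / 24 * h ^ 2 * (G - G')| ≤ α / 24 * (K * |p - α / 2|) * h ^ 3 := by
      rw [abs_mul, abs_of_nonneg hpos]
      refine (mul_le_mul_of_nonneg_left b₂ hpos).trans (le_of_eq (by ring))
    rw [e]
    have := abs_add_le (S - F - α / 24 * h ^ 2 * G) (α / 24 * h ^ 2 * (G - G'))
    linarith
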